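/- Let $\Sigma$ be a finite, non-empty, totally ordered alphabet and let $w\ge 1$ be an integer. A $(\Sigma,w)$-layer is a tuple $B=(\ell,r,T,I,F,\iota,\phi)$ with left states $\ell\subseteq\{0,\dots,w-1\}$, right states $r\subseteq\{0,\dots,w-1\}$, transitions $T\subseteq \ell\times\Sigma\times r$, initial states $I\subseteq \ell$, final states $F\subseteq r$ and flags $\iota,\phi\in\{0,1\}$ such that $I=\emptyset$ if $\iota=0$ and $F=\emptyset$ if $\phi=0$. Let $\mathcal{B}(\Sigma,w)$ be the set of all $(\Sigma,w)$-layers. A layer is deterministic if $\iota=1$ implies $I=\ell$ and $|\ell|=1$, and every $(p,a)\in \ell\times\Sigma$ has at most one transition $(p,a,q)\in T$; it is complete if $\iota=1$ implies $I\ne\emptyset$, and every $(p,a)\in \ell\times\Sigma$ has at least one transition. Let $\widehat{\mathcal{B}}(\Sigma,w)$ be the set of deterministic, complete $(\Sigma,w)$-layers. A $(\Sigma,w)$-ODD of length $k\ge1$ is a string $D=B_1\cdots B_k$ of $(\Sigma,w)$-layers such that $\ell(B_{i+1})=r(B_i)$ for $1\le i<k$, $\iota(B_i)=1$ iff $i=1$,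 and $\phi(B_i)=1$ iff $i=k$. It is deterministic (complete) if all its layers are. Its language is the pair $\mathcal{L}(D)=(k,L)$, where $L$ is the set of all $a_1\cdots a_k\in\Sigma^k$ for which there are states $p_0,\dots,p_k$ with $p_0\in I(B_1)$, $(p_{i-1},a_i,p_i)\in T(B_i)$ for all $i$, and $p_k\in F(B_k)$. Its number of states is $|\ell(B_1)|+\sum_{i}|r(B_i)|$. A deterministic, complete ODD is minimized if no deterministic, complete ODD of any width with the same language has fewer states. A layer is normalized if it is deterministic, $\ell=\{0,\dots,w_1-1\}$ and $r=\{0,\dots,w_2-1\}$ for some $w_1,w_2\ge1$, every right state has an incoming transition, and for all $q,q'\in r$ one has $q<q'$ iff $\xi(q)<\xi(q')$, where $\xi(q)$ is the lexicographically least pair $(p,a)$ with $(p,a,q)\in T$; an ODD is normalized if all its layers are. A canonical form of an ODD $D$ is a deterministic, complete, minimized, normalized ODD with the same language as $D$. For sets of symbols $S_1,S_2$, an $(S_1,S_2)$-transduction is a set of pairs $(s,t)\in S_1^+\times S_2^+$ with $|s|=|t|$. It is functional if each $s$ occurs in at most one pair $(s,t)$, and it is $n$-regular if some nondeterministic finite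 automaton over $S_1\times S_2$ with at most $n$ states accepts exactly the strings $s\otimes t=(s_1,t_1)\cdots(s_k,t_k)$ for $(s,t)$ in the transduction. Theorem. Every $(\Sigma,w)$-ODD $D$ has exactly one canonical form $\mathcal{C}(D)$, and there is an absolute constant $c$ (independent of $\Sigma$ and $w$) such that the following hold. 1. $\{(D,\mathcal{C}(D)) : D \text{ a } (\Sigma,w)\text{-ODD}\}$ is a functional $(\mathcal{B}(\Sigma,w),\widehat{\mathcal{B}}(\Sigma,2^w))$-transduction that is $n$-regular for some $n\le 2^{c\,|\Sigma|\,w\,2^w}$. 2. $\{(D,\mathcal{C}(D)) : D \text{ a deterministic, complete } (\Sigma,w)\text{-ODD}\}$ is a functional $(\widehat{\mathcal{B}}(\Sigma,w),\widehat{\mathcal{B}}(\Sigma,w))$-transduction that is $n$-regular for some $n\le 2^{c\,|\Sigma|\,w\,\log_2\max(w,2)}$. -/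

import Mathlib

namespace ODD

universe u v

/-! ### Layers -/

/-- A layer over the alphabet `A`: left and right states, labelled transitions, initial and
final states, and the two Boolean flags. States are natural numbers; the width restriction is
imposed by `layers`. -/
@[ext]
structure Layer (A : Type u) where
  left : Finset ℕ
  right : Finset ℕ
  trans : Finset (ℕ × A × ℕ)
  init : Finset ℕ
  final : Finset ℕ
  initFlag : Bool
  finalFlag : Bool
  trans_mem : ∀ p a q, (p, a, q) ∈ trans → p ∈ left ∧ q ∈ right
  init_subset : init ⊆ left
  final_subset : final ⊆ right
  init_eq_empty : initFlag = false → init = ∅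
  final_eq_empty : finalFlag = false → final = ∅

variable {A : Type u}

namespace Layer

def IsDeterministic (L : Layer A) : Prop :=
  (L.initFlag = true → L.init = L.left ∧ L.left.card = 1) ∧
  ∀ p ∈ L.left, ∀ a : A, ∀ q ∈ L.right, ∀ q' ∈ L.right,
    (p, a, q) ∈ L.trans → (p, a, q') ∈ L.trans → q = q'

def IsComplete (L : Layer A) : Prop :=
  (L.initFlag = true → L.init ≠ ∅) ∧
  ∀ p ∈ L.left, ∀ a : A, ∃ q ∈ L.right, (p, a, q) ∈ L.trans

def IsReachable (L : Layer A) : Prop :=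
  ∀ q ∈ L.right, ∃ a : A, ∃ p ∈ L.left, (p, a, q) ∈ L.trans

/-- The pairs `(p, a)`, ordered lexicographically, with a transition `(p, a, q)`. -/
def incoming (L : Layer A) (q : ℕ) : Set (ℕ ×ₗ A) :=
  {x | ((ofLex x).1, (ofLex x).2, q) ∈ L.trans}

/-- Reachable, deterministic, and right states are ordered as their lexicographically least
incoming pairs `(p, a)`. -/
def IsWellOrdered [LinearOrder A] (L : Layer A) : Prop :=
  L.IsReachable ∧ L.IsDeterministic ∧
  ∀ q ∈ L.right, ∀ q' ∈ L.right, ∀ x x' : ℕ ×ₗ A,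
    IsLeast (L.incoming q) x → IsLeast (L.incoming q') x' → (q < q' ↔ x < x')

def IsContiguous (L : Layer A) : Prop :=
  ∃ w₁ w₂ : ℕ, 1 ≤ w₁ ∧ 1 ≤ w₂ ∧ L.left = Finset.range w₁ ∧ L.right = Finset.range w₂

def IsNormalized [LinearOrder A] (L : Layer A) : Prop :=
  L.IsWellOrdered ∧ L.IsContiguous

end Layer

/-- The alphabet of all layers of width at most `w`: the states lie in `{0, …, w - 1}`. -/
def layers (A : Type u) (w : ℕ) : Set (Layer A) :=
  {L | L.left ⊆ Finset.range w ∧ L.right ⊆ Finset.range w}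

/-- The alphabet of all deterministic, complete layers of width at most `w`. -/
def cdLayers (A : Type u) (w : ℕ) : Set (Layer A) :=
  {L | L ∈ layers A w ∧ L.IsDeterministic ∧ L.IsComplete}

/-! ### Ordered decision diagrams -/

/-- A nonempty string of layers is an ODD if consecutive frontiers agree, exactly the first layer
has its initial flag set, and exactly the last layer has its final flag set. -/
def IsODD (D : List (Layer A)) : Prop :=
  D ≠ [] ∧
  (∀ (i : ℕ) (h : i + 1 < D.length), (D[i + 1]).left = (D[i]).right) ∧
  (∀ (i : ℕ) (h : i < D.length), (D[i]).initFlag = true ↔ i = 0) ∧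
  (∀ (i : ℕ) (h : i < D.length), (D[i]).finalFlag = true ↔ i + 1 = D.length)

/-- The set of all ODDs of width at most `w`. -/
def odds (A : Type u) (w : ℕ) : Set (List (Layer A)) :=
  {D | IsODD D ∧ ∀ L ∈ D, L ∈ layers A w}

/-- The set of all deterministic, complete ODDs of width at most `w`. -/
def cdOdds (A : Type u) (w : ℕ) : Set (List (Layer A)) :=
  {D | IsODD D ∧ ∀ L ∈ D, L ∈ cdLayers A w}

/-- `D` accepts `s` if there is a sequence of states `p 0, …, p k`, with `k` the common length of
`D` and `s`, from an initial to a final state, following transitions labelled by `s`. -/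
def Accepts (D : List (Layer A)) (s : List A) : Prop :=
  ∃ (hs : s.length = D.length) (hD : D ≠ []) (p : ℕ → ℕ),
    p 0 ∈ (D.head hD).init ∧
    (∀ (i : ℕ) (h : i < D.length), (p i, s[i]'(hs ▸ h), p (i + 1)) ∈ (D[i]).trans) ∧
    p D.length ∈ (D.getLast hD).final

/-- The length-typed language of an ODD. -/
def lang (D : List (Layer A)) : ℕ × Set (List A) :=
  (D.length, {s | Accepts D s})

/-- The number of left states of the first layer plus the numbers of right states of all layers. -/
def numStates (D : List (Layer A)) : ℕ :=
  (D.head?.elim 0 fun L => L.left.card) + (D.map fun L => L.right.card).sum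

/-- `D` has the least number of states among all deterministic, complete ODDs, of any width, with
the same language. -/
def IsMinimized (D : List (Layer A)) : Prop :=
  ∀ w : ℕ, 1 ≤ w → ∀ D' ∈ cdOdds A w, lang D' = lang D → numStates D ≤ numStates D'

/-- `C` is a canonical form of `D`: a deterministic, complete, minimized, normalized ODD (of
whatever width) with the same language as `D`. -/
def IsCanonicalForm [LinearOrder A] (D C : List (Layer A)) : Prop :=
  IsODD C ∧ (∀ L ∈ C, L.IsDeterministic) ∧ (∀ L ∈ C, L.IsComplete) ∧
  IsMinimized C ∧ (∀ L ∈ C, L.IsNormalized) ∧ lang C = lang D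

/-! ### Finite automata and transductions -/

/-- The language `K` over the alphabet `S` is accepted by a nondeterministic finite automaton over
`S` with at most `n` states. -/
def IsRegularLang {α : Type u} (S : Set α) (n : ℕ) (K : Language α) : Prop :=
  ∃ (Q : Type) (_ : Fintype Q) (M : NFA α Q),
    Fintype.card Q ≤ n ∧ (∀ q a, (M.step q a).Nonempty → a ∈ S) ∧ M.accepts = K

/-- A length-preserving relation between nonempty strings over `S₁` and over `S₂`. -/
def IsTransduction {α : Type u} {β : Type v} (S₁ : Set α) (S₂ : Set β)
    (T : Set (List α × List β)) : Prop :=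
  ∀ x ∈ T, x.1 ≠ [] ∧ x.2 ≠ [] ∧ x.1.length = x.2.length ∧
    (∀ a ∈ x.1, a ∈ S₁) ∧ ∀ b ∈ x.2, b ∈ S₂

def IsFunctional {α : Type u} {β : Type v} (T : Set (List α × List β)) : Prop :=
  ∀ s t t', (s, t) ∈ T → (s, t') ∈ T → t = t'

def dom {α : Type u} {β : Type v} (T : Set (List α × List β)) : Set (List α) :=
  {s | ∃ t, (s, t) ∈ T}

/-- The language of all tensor products `s ⊗ t` with `(s, t) ∈ T`. -/
def tensorLang {α : Type u} {β : Type v} (T : Set (List α × List β)) : Language (α × β) :=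
  {z | ∃ x ∈ T, z = x.1.zip x.2}

/-- `T` is an `n`-regular `(S₁, S₂)`-transduction. -/
def IsRegularTransduction {α : Type u} {β : Type v} (S₁ : Set α) (S₂ : Set β) (n : ℕ)
    (T : Set (List α × List β)) : Prop :=
  IsTransduction S₁ S₂ T ∧ IsRegularLang (S₁ ×ˢ S₂) n (tensorLang T)

/-- The pairs `(D, C)` with `D` an ODD of width at most `w` and `C` its canonical form. -/
def canonization (A : Type u) [LinearOrder A] (w : ℕ) :
    Set (List (Layer A) × List (Layer A)) :=
  {x | x.1 ∈ odds A w ∧ IsCanonicalForm x.1 x.2}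

/-- The pairs `(D, C)` with `D` a deterministic, complete ODD of width at most `w` and `C` its
canonical form. -/
def cdCanonization (A : Type u) [LinearOrder A] (w : ℕ) :
    Set (List (Layer A) × List (Layer A)) :=
  {x | x.1 ∈ cdOdds A w ∧ IsCanonicalForm x.1 x.2}

end ODD

namespace ODD

universe u v

/-! ### Strings of layers as padded sequences -/

variable {A : Type u}

/-! This is the Myhill–Nerode theorem for levelled automata, followed by a local check of its
outcome.

Existence: the residuals of the language after each number of letters, numbered level by level by
their least incoming pair, are the states of a normalized ODD (`exists_reduced_normalized`). It is
also reduced: distinct left states of a layer have distinct outgoing transitions, and the last layer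
separates its right states by finality.

Uniqueness: reducedness propagates backwards from the last level, so the state that a reduced ODD
reaches on a word depends only on the set of states that any equivalent ODD reaches on that word
(`run_eq_of_reach_eq`). Hence a reachable reduced ODD is smallest at every level separately, and a
minimized ODD has the same number of states at each level. The resulting levelwise bijection
preserves transitions, and ordering by least incoming pairs forces it to be the identity
(`seq_eq_of_card_eq`).

Consequently "canonical" means "normalized, reduced and equivalent" (`isCanonicalForm_iff`). The
first two conditions concern single layers. For equivalence, an automaton reading `D ⊗ C` guesses at
each level a relation containing all pairs (set reached in `D`, state reached in `C`), and compares
finality at the end. The exact relation is a partial function on the family `P` of possible sets, so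
about `(|P| + 1) ^ (|P| + 1)` guesses suffice, times `2 ^ w` for the current frontier of `D`. In
general `P` consists of all subsets of `{0, …, w - 1}`; for deterministic, complete `D` it consists
of the `w` singletons. The number of states does not involve the alphabet; the factor `|Σ|` in the
exponents is slack. -/

instance : Inhabited (Layer A) :=
  ⟨⟨∅, ∅, ∅, ∅, ∅, false, false, by simp, by simp, by simp, by simp, by simp⟩⟩

/-- The layers of `D` as an infinite sequence, padded with empty layers. -/
def seq (D : List (Layer A)) (i : ℕ) : Layer A := D.getD i default

theorem seq_eq_getElem (D : List (Layer A)) {i : ℕ} (h : i < D.length) : seq D i = D[i] := by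
  simp [seq, h]

theorem forall_mem_iff_seq {D : List (Layer A)} {P : Layer A → Prop} :
    (∀ L ∈ D, P L) ↔ ∀ i < D.length, P (seq D i) := by
  constructor
  · intro h i hi
    rw [seq_eq_getElem D hi]
    exact h _ (List.getElem_mem hi)
  · intro h L hL
    obtain ⟨i, hi, rfl⟩ := List.mem_iff_getElem.1 hL
    rw [← seq_eq_getElem D hi]
    exact h i hi

theorem ext_seq {D D' : List (Layer A)} (hl : D.length = D'.length)
    (h : ∀ i < D.length, seq D i = seq D' i) : D = D' := by
  refine List.ext_getElem hl fun i h1 h2 => ?_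
  rw [← seq_eq_getElem D h1, ← seq_eq_getElem D' h2, h i h1]

theorem seq_map_range (B : ℕ → Layer A) {k i : ℕ} (hi : i < k) :
    seq ((List.range k).map B) i = B i := by
  rw [seq_eq_getElem _ (by simpa using hi)]
  simp

/-- The first `k` members of a sequence of layers form an ODD. -/
structure IsODDSeq (B : ℕ → Layer A) (k : ℕ) : Prop where
  pos : 0 < k
  left_succ : ∀ i, i + 1 < k → (B (i + 1)).left = (B i).right
  initFlag : ∀ i < k, ((B i).initFlag = true ↔ i = 0)
  finalFlag : ∀ i < k, ((B i).finalFlag = true ↔ i + 1 = k)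

theorem isODD_iff {D : List (Layer A)} : IsODD D ↔ IsODDSeq (seq D) D.length := by
  constructor
  · rintro ⟨h0, h1, h2, h3⟩
    refine ⟨List.length_pos_iff.2 h0, fun i hi => ?_, fun i hi => ?_, fun i hi => ?_⟩
    · rw [seq_eq_getElem D hi, seq_eq_getElem D (by omega)]
      exact h1 i hi
    · rw [seq_eq_getElem D hi]
      exact h2 i hi
    · rw [seq_eq_getElem D hi]
      exact h3 i hi
  · rintro ⟨h0, h1, h2, h3⟩
    refine ⟨List.length_pos_iff.1 h0, fun i hi => ?_, fun i hi => ?_, fun i hi => ?_⟩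
    · rw [← seq_eq_getElem D hi, ← seq_eq_getElem D (by omega)]
      exact h1 i hi
    · rw [← seq_eq_getElem D hi]
      exact h2 i hi
    · rw [← seq_eq_getElem D hi]
      exact h3 i hi

theorem IsODDSeq.congr {B B' : ℕ → Layer A} {k : ℕ} (h : IsODDSeq B k)
    (hB : ∀ i < k, B' i = B i) : IsODDSeq B' k := by
  refine ⟨h.pos, fun i hi => ?_, fun i hi => ?_, fun i hi => ?_⟩
  · rw [hB _ hi, hB i (by omega), h.left_succ i hi]
  · rw [hB i hi, h.initFlag i hi]
  · rw [hB i hi, h.finalFlag i hi]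

/-! ### The subset construction -/

open scoped Classical in
/-- The states to which some state in `S` has a transition labelled by `a`. -/
noncomputable def Layer.next (L : Layer A) (S : Finset ℕ) (a : A) : Finset ℕ :=
  (L.trans.filter fun t => t.1 ∈ S ∧ t.2.1 = a).image fun t => t.2.2

@[simp]
theorem Layer.mem_next {L : Layer A} {S : Finset ℕ} {a : A} {q : ℕ} :
    q ∈ L.next S a ↔ ∃ p ∈ S, (p, a, q) ∈ L.trans := by
  classical
  simp only [Layer.next, Finset.mem_image, Finset.mem_filter, Prod.exists]
  constructor
  · rintro ⟨p, b, r, ⟨h, hp, rfl⟩, rfl⟩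
    exact ⟨p, hp, h⟩
  · rintro ⟨p, hp, h⟩
    exact ⟨p, a, q, ⟨h, hp, rfl⟩, rfl⟩

/-- The states reached after reading the first `i` letters of `u`. -/
noncomputable def reach (B : ℕ → Layer A) (u : ℕ → A) : ℕ → Finset ℕ
  | 0 => (B 0).init
  | i + 1 => (B i).next (reach B u i) (u i)

@[simp] theorem reach_zero (B : ℕ → Layer A) (u : ℕ → A) : reach B u 0 = (B 0).init := rfl

@[simp] theorem reach_succ (B : ℕ → Layer A) (u : ℕ → A) (i : ℕ) :
    reach B u (i + 1) = (B i).next (reach B u i) (u i) := rfl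

theorem reach_congr_word (B : ℕ → Layer A) {u u' : ℕ → A} {i : ℕ} (h : ∀ j < i, u j = u' j) :
    reach B u i = reach B u' i := by
  induction i with
  | zero => rfl
  | succ i ih =>
    rw [reach_succ, reach_succ, ih fun j hj => h j (by omega), h i (by omega)]

theorem reach_congr_seq {B B' : ℕ → Layer A} (u : ℕ → A) {k i : ℕ} (h0 : 0 < k) (hi : i ≤ k)
    (h : ∀ j < k, B j = B' j) : reach B u i = reach B' u i := by
  induction i with
  | zero => simp [h 0 h0]
  | succ i ih => rw [reach_succ, reach_succ, ih (by omega), h i (by omega)]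

/-- Words are infinite sequences of which only a prefix is read, so appending `a` after `i` letters
is `Function.update u i a`, which leaves the prefix untouched. -/
theorem reach_update (B : ℕ → Layer A) (u : ℕ → A) (i : ℕ) (a : A) :
    reach B (Function.update u i a) i = reach B u i :=
  reach_congr_word B fun j hj => by simp [Function.update_of_ne (Nat.ne_of_lt hj)]

theorem reach_update_succ (B : ℕ → Layer A) (u : ℕ → A) (i : ℕ) (a : A) :
    reach B (Function.update u i a) (i + 1) = (B i).next (reach B u i) a := by
  rw [reach_succ, reach_update, Function.update_self]

/-- The first `k` layers of `B` accept the first `k` letters of `u`. -/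
def AcceptsSeq (B : ℕ → Layer A) (k : ℕ) (u : ℕ → A) : Prop :=
  ∃ q ∈ reach B u k, q ∈ (B (k - 1)).final

theorem acceptsSeq_congr_word (B : ℕ → Layer A) {k : ℕ} {u u' : ℕ → A} (h : ∀ j < k, u j = u' j) :
    AcceptsSeq B k u ↔ AcceptsSeq B k u' := by
  rw [AcceptsSeq, AcceptsSeq, reach_congr_word B h]

theorem mem_reach_iff (B : ℕ → Layer A) (u : ℕ → A) (i q : ℕ) :
    q ∈ reach B u i ↔ ∃ p : ℕ → ℕ, p 0 ∈ (B 0).init ∧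
      (∀ j < i, (p j, u j, p (j + 1)) ∈ (B j).trans) ∧ p i = q := by
  induction i generalizing q with
  | zero =>
    constructor
    · intro h
      exact ⟨fun _ => q, h, by simp, rfl⟩
    · rintro ⟨p, h, -, rfl⟩
      exact h
  | succ i ih =>
    rw [reach_succ, Layer.mem_next]
    constructor
    · rintro ⟨p', hp', ht⟩
      obtain ⟨p, h0, h1, rfl⟩ := (ih _).1 hp'
      refine ⟨Function.update p (i + 1) q, by simpa using h0, fun j hj => ?_, by simp⟩
      rcases Nat.lt_succ_iff_lt_or_eq.1 hj with hj | rfl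
      · rw [Function.update_of_ne (by omega), Function.update_of_ne (by omega)]
        exact h1 j hj
      · rw [Function.update_of_ne (by omega), Function.update_self]
        exact ht
    · rintro ⟨p, h0, h1, rfl⟩
      exact ⟨p i, (ih _).2 ⟨p, h0, fun j hj => h1 j (by omega), rfl⟩, h1 i (by omega)⟩

/-- The padding letter is never read: the length condition makes all positions below `D.length`
genuine. -/
theorem accepts_iff [Inhabited A] {D : List (Layer A)} (hD : D ≠ []) (s : List A) :
    Accepts D s ↔ s.length = D.length ∧ AcceptsSeq (seq D) D.length fun i => s.getD i default := by
  have hpos := List.length_pos_iff.2 hD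
  have hhead : D.head hD = seq D 0 := by
    rw [seq_eq_getElem D hpos, List.head_eq_getElem]
  have hlast : D.getLast hD = seq D (D.length - 1) := by
    rw [seq_eq_getElem D (by omega), List.getLast_eq_getElem]
  constructor
  · rintro ⟨hs, _, p, h0, h1, h2⟩
    refine ⟨hs, p D.length, ?_, hlast ▸ h2⟩
    rw [mem_reach_iff]
    refine ⟨p, hhead ▸ h0, fun j hj => ?_, rfl⟩
    have := h1 j hj
    rw [seq_eq_getElem D hj]
    simpa [hs, hj] using this
  · rintro ⟨hs, q, hq, hf⟩
    obtain ⟨p, h0, h1, rfl⟩ := (mem_reach_iff _ _ _ _).1 hq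
    refine ⟨hs, hD, p, hhead ▸ h0, fun j hj => ?_, hlast ▸ hf⟩
    have := h1 j hj
    rw [seq_eq_getElem D hj] at this
    simpa [hs, hj] using this

theorem lang_eq_iff [Nonempty A] {D D' : List (Layer A)} (hD : D ≠ []) (hD' : D' ≠ []) :
    lang D = lang D' ↔ D.length = D'.length ∧
      ∀ u, AcceptsSeq (seq D) D.length u ↔ AcceptsSeq (seq D') D.length u := by
  inhabit A
  simp only [lang, Prod.mk.injEq, Set.ext_iff, Set.mem_ofPred_eq, accepts_iff hD, accepts_iff hD']
  refine and_congr_right fun hl => ?_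
  rw [← hl]
  constructor
  · intro h u
    have := h (List.ofFn fun i : Fin D.length => u i)
    simp only [List.length_ofFn, true_and] at this
    have key : ∀ j < D.length, u j = (List.ofFn fun i : Fin D.length => u i).getD j default := by
      intro j hj
      simp [hj]
    rw [acceptsSeq_congr_word _ key, acceptsSeq_congr_word _ key]
    exact this
  · intro h s
    rw [h]

/-! ### States of an ODD -/

/-- The states of an ODD after `i` letters. -/
def level (B : ℕ → Layer A) : ℕ → Finset ℕ
  | 0 => (B 0).left
  | i + 1 => (B i).right

@[simp] theorem level_zero (B : ℕ → Layer A) : level B 0 = (B 0).left := rfl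

@[simp] theorem level_succ (B : ℕ → Layer A) (i : ℕ) : level B (i + 1) = (B i).right := rfl

theorem IsODDSeq.left_eq {B : ℕ → Layer A} {k : ℕ} (h : IsODDSeq B k) {i : ℕ} (hi : i < k) :
    (B i).left = level B i := by
  cases i with
  | zero => rfl
  | succ i => exact h.left_succ i hi

theorem reach_subset_level (B : ℕ → Layer A) (u : ℕ → A) (i : ℕ) : reach B u i ⊆ level B i := by
  cases i with
  | zero => exact (B 0).init_subset
  | succ i =>
    intro q hq
    obtain ⟨p, -, h⟩ := Layer.mem_next.1 hq
    exact ((B i).trans_mem _ _ _ h).2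

/-- Counting by levels lets minimality be compared one level at a time. -/
theorem numStates_eq {D : List (Layer A)} (hD : D ≠ []) :
    numStates D = ∑ i ∈ Finset.range (D.length + 1), (level (seq D) i).card := by
  rw [Finset.sum_range_succ', add_comm, numStates]
  congr 1
  · cases D with
    | nil => exact absurd rfl hD
    | cons L D => rfl
  · have : D = (List.range D.length).map (seq D) := by
      refine ext_seq (by simp) fun i hi => ?_
      rw [seq_map_range _ hi]
    conv_lhs => rw [this]
    simp [Finset.sum, Finset.range, Multiset.range, Function.comp_def]

/-- The first `k` members of `B` form a deterministic, complete ODD. -/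
structure IsCDSeq (B : ℕ → Layer A) (k : ℕ) : Prop extends IsODDSeq B k where
  det : ∀ i < k, (B i).IsDeterministic
  complete : ∀ i < k, (B i).IsComplete

/-- The state of a deterministic, complete ODD after `i` letters of `u`. -/
noncomputable def run (B : ℕ → Layer A) (u : ℕ → A) (i : ℕ) : ℕ := (reach B u i).sup id

/-- The supremum in `run` serves only to extract the element of a singleton. -/
theorem run_eq_of_reach {B : ℕ → Layer A} {u : ℕ → A} {i q : ℕ} (h : reach B u i = {q}) :
    run B u i = q := by
  simp [run, h]

theorem IsODDSeq.init_eq_left {B : ℕ → Layer A} {k : ℕ} (h : IsODDSeq B k)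
    (hd : (B 0).IsDeterministic) : (B 0).init = (B 0).left :=
  (hd.1 ((h.initFlag 0 h.pos).2 rfl)).1

namespace IsCDSeq

variable {B : ℕ → Layer A} {k : ℕ}

/-- Completeness keeps the set of reached states nonempty and determinism keeps it from growing
beyond the single initial state. -/
theorem reach_eq (h : IsCDSeq B k) (u : ℕ → A) {i : ℕ} (hi : i ≤ k) :
    reach B u i = {run B u i} := by
  suffices H : ∃ q, reach B u i = {q} by
    obtain ⟨q, hq⟩ := H
    rw [run_eq_of_reach hq, hq]
  induction i with
  | zero =>
    have := (h.det 0 h.pos).1 ((h.initFlag 0 h.pos).2 rfl)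
    rw [reach_zero, this.1]
    exact Finset.card_eq_one.1 this.2
  | succ i ih =>
    obtain ⟨p, hp⟩ := ih (by omega)
    have hpl : p ∈ (B i).left := by
      rw [h.left_eq hi]
      exact reach_subset_level B u i (by simp [hp])
    obtain ⟨q, hq, ht⟩ := (h.complete i hi).2 p hpl (u i)
    refine ⟨q, ?_⟩
    ext q'
    rw [reach_succ, hp, Layer.mem_next]
    simp only [Finset.mem_singleton, exists_eq_left]
    constructor
    · intro h'
      exact (h.det i hi).2 p hpl (u i) q' ((B i).trans_mem _ _ _ h').2 q hq h' ht
    · rintro rfl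
      exact ht

theorem run_mem (h : IsCDSeq B k) (u : ℕ → A) {i : ℕ} (hi : i ≤ k) : run B u i ∈ level B i :=
  reach_subset_level B u i (by simp [h.reach_eq u hi])

theorem run_trans (h : IsCDSeq B k) (u : ℕ → A) {i : ℕ} (hi : i < k) {q : ℕ} :
    (run B u i, u i, q) ∈ (B i).trans ↔ q = run B u (i + 1) := by
  have := h.reach_eq u (i := i + 1) hi
  rw [reach_succ, h.reach_eq u hi.le, Finset.ext_iff] at this
  simpa using this q

theorem acceptsSeq_iff (h : IsCDSeq B k) (u : ℕ → A) :
    AcceptsSeq B k u ↔ run B u k ∈ (B (k - 1)).final := by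
  simp [AcceptsSeq, h.reach_eq u le_rfl]

theorem run_update (u : ℕ → A) (i : ℕ) (a : A) :
    run B (Function.update u i a) i = run B u i := by
  rw [run, reach_update, run]

theorem run_trans_update (h : IsCDSeq B k) (u : ℕ → A) {i : ℕ} (hi : i < k) {a : A} {q : ℕ} :
    (run B u i, a, q) ∈ (B i).trans ↔ q = run B (Function.update u i a) (i + 1) := by
  have := h.run_trans (Function.update u i a) hi (q := q)
  rwa [run_update, Function.update_self] at this

/-- In an ODD with reachable layers every state is the state after some word. -/
theorem exists_run_eq [Nonempty A] (h : IsCDSeq B k) (hr : ∀ i < k, (B i).IsReachable) {i : ℕ}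
    (hi : i ≤ k) {q : ℕ} (hq : q ∈ level B i) : ∃ u, run B u i = q := by
  inhabit A
  induction i generalizing q with
  | zero =>
    refine ⟨fun _ => default, ?_⟩
    have h1 := h.reach_eq (fun _ => default) hi
    rw [reach_zero, h.init_eq_left (h.det 0 h.pos)] at h1
    rw [level_zero, h1, Finset.mem_singleton] at hq
    exact hq.symm
  | succ i ih =>
    obtain ⟨a, p, hp, ht⟩ := hr i hi q hq
    obtain ⟨u, rfl⟩ := ih (by omega) (h.left_eq hi ▸ hp)
    exact ⟨_, ((h.run_trans_update u hi).1 ht).symm⟩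

end IsCDSeq

/-! ### Reduced ODDs -/

/-- Distinct left states have distinct outgoing transitions, and, in a last layer, right states
are distinguished by being final. -/
def Layer.IsReduced (L : Layer A) : Prop :=
  (∀ p ∈ L.left, ∀ p' ∈ L.left, (∀ a q, (p, a, q) ∈ L.trans ↔ (p', a, q) ∈ L.trans) → p = p') ∧
  (L.finalFlag = true → ∀ q ∈ L.right, ∀ q' ∈ L.right, (q ∈ L.final ↔ q' ∈ L.final) → q = q')

/-- Words that lead to the same states of an ODD lead to the same state of an equivalent reduced
ODD. -/
theorem run_eq_of_reach_eq {B C : ℕ → Layer A} {k : ℕ} (hC : IsCDSeq C k)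
    (hr : ∀ i < k, (C i).IsReduced) (hL : ∀ u, AcceptsSeq C k u ↔ AcceptsSeq B k u)
    {i : ℕ} (hi : i ≤ k) {u u' : ℕ → A} (h : reach B u i = reach B u' i) :
    run C u i = run C u' i := by
  -- Backwards from level `k`: there, equal sets give equal acceptance, and the last layer separates
  -- states by finality. At an earlier level, equal sets stay equal after any further letter, so
  -- both states have the same outgoing transitions and coincide by reducedness.
  induction hi using Nat.decreasingInduction generalizing u u' with
  | self =>
    have hk : k - 1 < k := Nat.sub_lt hC.pos one_pos
    have hk' : k - 1 + 1 = k := Nat.sub_add_cancel hC.pos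
    have hm : ∀ v, run C v k ∈ (C (k - 1)).right := fun v => by
      have := hC.run_mem v le_rfl
      rw [← hk'] at this ⊢
      exact this
    refine (hr _ hk).2 ((hC.finalFlag _ hk).2 hk') _ (hm u) _ (hm u') ?_
    rw [← hC.acceptsSeq_iff, ← hC.acceptsSeq_iff, hL, hL, AcceptsSeq, AcceptsSeq, h]
  | of_succ i hi ih =>
    have hm : ∀ v, run C v i ∈ (C i).left := fun v => hC.left_eq hi ▸ hC.run_mem v hi.le
    refine (hr i hi).1 _ (hm u) _ (hm u') fun a q => ?_
    rw [hC.run_trans_update u hi, hC.run_trans_update u' hi,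
      ih (u := Function.update u i a) (u' := Function.update u' i a)]
    rw [reach_update_succ, reach_update_succ, h]

/-- Choosing a word for each state of `C` and sending the state to the set that this word reaches in
`B` is injective by `run_eq_of_reach_eq`. This is the source of both width bounds, `2 ^ w` and `w`.
-/
theorem card_level_le_of_reach_mem [Nonempty A] {B C : ℕ → Layer A} {k : ℕ} (hC : IsCDSeq C k)
    (hreach : ∀ i < k, (C i).IsReachable)
    (hr : ∀ i < k, (C i).IsReduced) (hL : ∀ u, AcceptsSeq C k u ↔ AcceptsSeq B k u)
    {i : ℕ} (hi : i ≤ k) {P : Finset (Finset ℕ)} (hP : ∀ u, reach B u i ∈ P) :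
    (level C i).card ≤ P.card := by
  have hsurj : ∀ q ∈ level C i, ∃ u, run C u i = q := fun q => hC.exists_run_eq hreach hi
  choose! f hf using hsurj
  refine Finset.card_le_card_of_injOn (fun q => reach B (f q) i) (fun q _ => hP _) ?_
  intro q hq q' hq' h
  rw [← hf q hq, ← hf q' hq']
  exact run_eq_of_reach_eq hC hr hL hi h

theorem card_level_le [Nonempty A] {B C : ℕ → Layer A} {k : ℕ} (hC : IsCDSeq C k)
    (hreach : ∀ i < k, (C i).IsReachable)
    (hr : ∀ i < k, (C i).IsReduced) (hL : ∀ u, AcceptsSeq C k u ↔ AcceptsSeq B k u)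
    (hB : IsCDSeq B k) {i : ℕ} (hi : i ≤ k) :
    (level C i).card ≤ (level B i).card := by
  have := card_level_le_of_reach_mem (P := (level B i).image fun q => {q}) hC hreach hr hL hi
    fun u => by
      rw [hB.reach_eq u hi]
      exact Finset.mem_image_of_mem _ (hB.run_mem u hi)
  exact this.trans Finset.card_image_le

/-! ### Uniqueness -/

/-- A deterministic, complete, normalized ODD. -/
structure IsNormalizedSeq [LinearOrder A] (B : ℕ → Layer A) (k : ℕ) : Prop
    extends IsCDSeq B k where
  normalized : ∀ i < k, (B i).IsNormalized

namespace IsNormalizedSeq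

variable [LinearOrder A] {B : ℕ → Layer A} {k : ℕ}

theorem reachable (h : IsNormalizedSeq B k) (i : ℕ) (hi : i < k) : (B i).IsReachable :=
  (h.normalized i hi).1.1

theorem level_eq_range (h : IsNormalizedSeq B k) {i : ℕ} (hi : i ≤ k) :
    level B i = Finset.range (level B i).card := by
  cases i with
  | zero =>
    obtain ⟨w, w', -, -, h1, -⟩ := (h.normalized 0 h.pos).2
    rw [level_zero, h1, Finset.card_range]
  | succ i =>
    obtain ⟨w, w', -, -, -, h1⟩ := (h.normalized i hi).2
    rw [level_succ, h1, Finset.card_range]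

end IsNormalizedSeq

/-- An increasing map cannot fall below the identity, by induction from `0`, nor rise above it
without leaving the range, by induction on the distance `d` from the top. -/
theorem eqOn_range_of_strictMonoOn {n : ℕ} {φ : ℕ → ℕ}
    (hm : ∀ q < n, φ q < n) (hφ : ∀ q < n, ∀ q' < n, q < q' → φ q < φ q') :
    ∀ q < n, φ q = q := by
  have h1 : ∀ q, q < n → q ≤ φ q := by
    intro q
    induction q with
    | zero => simp
    | succ q ih =>
      intro hq
      have := hφ q (by omega) (q + 1) hq (by omega)
      have := ih (by omega)
      omega
  have h2 : ∀ d q, q + d + 1 = n → φ q ≤ q := by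
    intro d
    induction d with
    | zero =>
      intro q hq
      have := hm q (by omega)
      omega
    | succ d ih =>
      intro q hq
      have := ih (q + 1) (by omega)
      have := hφ q (by omega) (q + 1) (by omega) (by omega)
      omega
  intro q hq
  exact le_antisymm (h2 (n - q - 1) q (by omega)) (h1 q hq)

/-- A layer has finitely many transitions, so the least pair exists for any linear order on the
letters. -/
theorem exists_isLeast_incoming [LinearOrder A] {L : Layer A} {a : A} {p q : ℕ}
    (h : (p, a, q) ∈ L.trans) : ∃ x, IsLeast (L.incoming q) x := by
  have hfin : (L.incoming q).Finite := by
    refine (L.trans.finite_toSet.image fun t => toLex (t.1, t.2.1)).subset fun x hx => ?_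
    exact ⟨_, hx, rfl⟩
  have hne : hfin.toFinset.Nonempty := ⟨toLex (p, a), hfin.mem_toFinset.2 h⟩
  exact ⟨_, by simpa using hfin.toFinset.isLeast_min' hne⟩

/-- Equivalent normalized ODDs with equally many states at every level, one of them reduced, have
the same runs. -/
theorem run_eq_run [Nonempty A] [LinearOrder A] {B C : ℕ → Layer A} {k : ℕ}
    (hC : IsNormalizedSeq C k) (hr : ∀ i < k, (C i).IsReduced)
    (hL : ∀ u, AcceptsSeq C k u ↔ AcceptsSeq B k u) (hB : IsNormalizedSeq B k)
    (hcard : ∀ i ≤ k, (level B i).card = (level C i).card) {i : ℕ} (hi : i ≤ k) (u : ℕ → A) :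
    run B u i = run C u i := by
  induction i generalizing u with
  | zero =>
    have h1 := hB.run_mem u (Nat.zero_le k)
    have h2 := hC.run_mem u (Nat.zero_le k)
    have h3 : (level C 0).card = 1 :=
      ((hC.det 0 hC.pos).1 ((hC.initFlag 0 hC.pos).2 rfl)).2
    rw [hC.level_eq_range hi, h3] at h2
    rw [hB.level_eq_range hi, hcard 0 hi, h3] at h1
    simp only [Finset.range_one, Finset.mem_singleton] at h1 h2
    rw [h1, h2]
  | succ i ih =>
    have hsurj : ∀ q ∈ level B (i + 1), ∃ u, run B u (i + 1) = q :=
      fun q => hB.exists_run_eq hB.reachable hi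
    choose! f hf using hsurj
    -- `φ` sends a state of `B` to the state of `C` reached by the same words; the choice of word is
    -- immaterial, and the goal is that `φ` is the identity on this level.
    set φ : ℕ → ℕ := fun q => run C (f q) (i + 1)
    have hφ : ∀ u, φ (run B u (i + 1)) = run C u (i + 1) := by
      intro u
      refine run_eq_of_reach_eq hC.toIsCDSeq hr hL hi ?_
      rw [hB.reach_eq _ hi, hB.reach_eq _ hi, hf _ (hB.run_mem u hi)]
    -- A surjection between finite sets of equal size is injective.
    have hinj : ∀ q ∈ level B (i + 1), ∀ q' ∈ level B (i + 1), φ q = φ q' → q = q' := by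
      have hs : Set.SurjOn φ (level B (i + 1)) (level C (i + 1)) := by
        intro q hq
        obtain ⟨u, rfl⟩ := hC.exists_run_eq hC.reachable hi hq
        exact ⟨run B u (i + 1), hB.run_mem u hi, hφ u⟩
      have hmaps : Set.MapsTo φ (level B (i + 1)) (level C (i + 1)) :=
        fun q _ => hC.run_mem _ hi
      have := Finset.injOn_of_surjOn_of_card_le φ hmaps hs (hcard _ hi).le
      exact fun q hq q' hq' h => this hq hq' h
    -- The previous levels are already numbered alike, so `φ` preserves incoming pairs. Both
    -- numberings follow the least such pair, which makes `φ` increasing.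
    have hinc : ∀ q ∈ level B (i + 1), (B i).incoming q = (C i).incoming (φ q) := by
      intro q hq
      ext x
      obtain ⟨p, a⟩ := x
      change (p, a, q) ∈ (B i).trans ↔ (p, a, φ q) ∈ (C i).trans
      constructor
      · intro h
        have hp := ((B i).trans_mem _ _ _ h).1
        rw [hB.left_eq hi] at hp
        obtain ⟨v, rfl⟩ := hB.exists_run_eq hB.reachable (by omega) hp
        rw [hB.run_trans_update v hi] at h
        rw [ih (by omega), hC.run_trans_update v hi, h, hφ]
      · intro h
        have hp := ((C i).trans_mem _ _ _ h).1
        rw [hC.left_eq hi] at hp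
        obtain ⟨v, rfl⟩ := hC.exists_run_eq hC.reachable (by omega) hp
        rw [hC.run_trans_update v hi, ← hφ] at h
        rw [← ih (by omega), hB.run_trans_update v hi]
        exact hinj _ hq _ (hB.run_mem _ hi) h
    have hid : ∀ q < (level B (i + 1)).card, φ q = q := by
      have hmem : ∀ q, q < (level B (i + 1)).card ↔ q ∈ level B (i + 1) := by
        intro q
        rw [← Finset.mem_range, ← hB.level_eq_range hi]
      have hmem' : ∀ q, q < (level B (i + 1)).card ↔ q ∈ level C (i + 1) := by
        intro q
        rw [hcard _ hi, ← Finset.mem_range, ← hC.level_eq_range hi]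
      refine eqOn_range_of_strictMonoOn (fun q _ => (hmem' _).2 (hC.run_mem _ hi)) ?_
      intro q hq q' hq' hlt
      rw [hmem] at hq hq'
      obtain ⟨a, p, -, ht⟩ := hB.reachable i hi q hq
      obtain ⟨a', p', -, ht'⟩ := hB.reachable i hi q' hq'
      obtain ⟨x, hx⟩ := exists_isLeast_incoming ht
      obtain ⟨x', hx'⟩ := exists_isLeast_incoming ht'
      have h1 := ((hB.normalized i hi).1.2.2 q hq q' hq' x x' hx hx').1 hlt
      rw [hinc q hq] at hx
      rw [hinc q' hq'] at hx'
      exact ((hC.normalized i hi).1.2.2 _ (hC.run_mem _ hi) _ (hC.run_mem _ hi) x x' hx hx').2 h1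
    rw [← hφ u, hid]
    rw [← Finset.mem_range, ← hB.level_eq_range hi]
    exact hB.run_mem u hi

/-- Every state lies on the run of some word, so equal runs determine all transitions, and equal
acceptance determines the final states. -/
theorem seq_eq_of_card_eq [Nonempty A] [LinearOrder A] {B C : ℕ → Layer A} {k : ℕ}
    (hC : IsNormalizedSeq C k) (hr : ∀ i < k, (C i).IsReduced)
    (hL : ∀ u, AcceptsSeq C k u ↔ AcceptsSeq B k u) (hB : IsNormalizedSeq B k)
    (hcard : ∀ i ≤ k, (level B i).card = (level C i).card) {i : ℕ} (hi : i < k) :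
    B i = C i := by
  have hrun : ∀ {j}, j ≤ k → ∀ u, run B u j = run C u j :=
    fun hj u => run_eq_run hC hr hL hB hcard hj u
  have hlev : ∀ j ≤ k, level B j = level C j := fun j hj => by
    rw [hB.level_eq_range hj, hcard j hj, ← hC.level_eq_range hj]
  have hleft : (B i).left = (C i).left := by
    rw [hB.left_eq hi, hC.left_eq hi, hlev i hi.le]
  have hinit : (B i).initFlag = (C i).initFlag := by
    rw [Bool.eq_iff_iff, hB.initFlag i hi, hC.initFlag i hi]
  have hfinal : (B i).finalFlag = (C i).finalFlag := by
    rw [Bool.eq_iff_iff, hB.finalFlag i hi, hC.finalFlag i hi]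
  refine Layer.ext hleft (hlev (i + 1) hi) ?_ ?_ ?_ hinit hfinal
  · ext ⟨p, a, q⟩
    constructor
    · intro h
      have hp := ((B i).trans_mem _ _ _ h).1
      rw [hB.left_eq hi] at hp
      obtain ⟨v, rfl⟩ := hB.exists_run_eq hB.reachable hi.le hp
      rw [hB.run_trans_update v hi] at h
      rw [hrun hi.le, hC.run_trans_update v hi, h, hrun hi]
    · intro h
      have hp := ((C i).trans_mem _ _ _ h).1
      rw [hC.left_eq hi] at hp
      obtain ⟨v, rfl⟩ := hC.exists_run_eq hC.reachable hi.le hp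
      rw [hC.run_trans_update v hi] at h
      rw [← hrun hi.le, hB.run_trans_update v hi, h, hrun hi]
  · cases hb : (B i).initFlag with
    | false => rw [(B i).init_eq_empty hb, (C i).init_eq_empty (hinit ▸ hb)]
    | true => rw [((hB.det i hi).1 hb).1, ((hC.det i hi).1 (hinit ▸ hb)).1, hleft]
  · cases hb : (B i).finalFlag with
    | false => rw [(B i).final_eq_empty hb, (C i).final_eq_empty (hfinal ▸ hb)]
    | true =>
      have hk := (hB.finalFlag i hi).1 hb
      obtain rfl : i = k - 1 := by omega
      have key : ∀ u, run B u k ∈ (B (k - 1)).final ↔ run B u k ∈ (C (k - 1)).final := by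
        intro u
        rw [← hB.acceptsSeq_iff, ← hL, hC.acceptsSeq_iff, hrun le_rfl]
      have hlk : ∀ q, q ∈ (B (k - 1)).right → ∃ u, run B u k = q := by
        intro q hq
        refine hB.exists_run_eq hB.reachable le_rfl ?_
        rw [← hk]
        exact hq
      ext q
      constructor
      · intro hq
        obtain ⟨u, rfl⟩ := hlk q ((B _).final_subset hq)
        exact (key u).1 hq
      · intro hq
        obtain ⟨u, rfl⟩ := hlk q (by
          have := hlev (k - 1 + 1) hi
          simp only [level_succ] at this
          rw [this]
          exact (C _).final_subset hq)
        exact (key u).2 hq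

/-! ### Ranks -/

section Rank

variable {S : Type*} {O : Type*} [LinearOrder O]

/-- The number of members of `X` with a smaller value of `ξ`. -/
def rank (X : Finset S) (ξ : S → O) (x : S) : ℕ := (X.filter fun y => ξ y < ξ x).card

theorem rank_lt_rank_iff {X : Finset S} {ξ : S → O} {x y : S} (hx : x ∈ X) :
    rank X ξ x < rank X ξ y ↔ ξ x < ξ y := by
  constructor
  · intro h
    by_contra hle
    refine absurd h (not_lt.2 (Finset.card_le_card fun z hz => ?_))
    rw [Finset.mem_filter] at hz ⊢
    exact ⟨hz.1, hz.2.trans_le (not_lt.1 hle)⟩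
  · intro h
    refine Finset.card_lt_card ⟨fun z hz => ?_, fun hsub => ?_⟩
    · rw [Finset.mem_filter] at hz ⊢
      exact ⟨hz.1, hz.2.trans h⟩
    · have := hsub (Finset.mem_filter.2 ⟨hx, h⟩)
      exact lt_irrefl _ (Finset.mem_filter.1 this).2

theorem rank_injOn {X : Finset S} {ξ : S → O} (hξ : Set.InjOn ξ X) : Set.InjOn (rank X ξ) X := by
  intro x hx y hy h
  refine hξ hx hy (le_antisymm ?_ ?_)
  · exact not_lt.1 fun hlt => h.not_gt ((rank_lt_rank_iff hy).2 hlt)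
  · exact not_lt.1 fun hlt => h.not_lt ((rank_lt_rank_iff hx).2 hlt)

theorem image_rank {X : Finset S} {ξ : S → O} (hξ : Set.InjOn ξ X) :
    X.image (rank X ξ) = Finset.range X.card := by
  refine Finset.eq_of_subset_of_card_le (fun q hq => ?_) ?_
  · obtain ⟨x, hx, rfl⟩ := Finset.mem_image.1 hq
    rw [Finset.mem_range]
    refine Finset.card_lt_card ⟨Finset.filter_subset _ _, fun h => ?_⟩
    exact lt_irrefl _ (Finset.mem_filter.1 (h hx)).2
  · rw [Finset.card_range, Finset.card_image_of_injOn (rank_injOn hξ)]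

end Rank

/-! ### The canonical ODD of a levelled deterministic transition system -/

section System

variable {S : Type v} (x₀ : S) (δ : ℕ → S → A → S)

/-- The state after `i` letters of `u`. -/
def orbit (u : ℕ → A) : ℕ → S
  | 0 => x₀
  | i + 1 => δ i (orbit u i) (u i)

variable [Fintype A]

open scoped Classical in
/-- The states reachable with `i` letters. -/
noncomputable def orbits : ℕ → Finset S
  | 0 => {x₀}
  | i + 1 => (orbits i ×ˢ (Finset.univ : Finset A)).image fun t => δ i t.1 t.2

theorem mem_orbits_succ {i : ℕ} {x : S} :
    x ∈ orbits x₀ δ (i + 1) ↔ ∃ y ∈ orbits x₀ δ i, ∃ a, δ i y a = x := by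
  classical
  simp [orbits]

theorem orbit_mem_orbits (u : ℕ → A) (i : ℕ) : orbit x₀ δ u i ∈ orbits x₀ δ i := by
  induction i with
  | zero => simp [orbit, orbits]
  | succ i ih => exact (mem_orbits_succ x₀ δ).2 ⟨_, ih, _, rfl⟩

theorem exists_orbit_eq [Nonempty A] {i : ℕ} {x : S} (hx : x ∈ orbits x₀ δ i) :
    ∃ u, orbit x₀ δ u i = x := by
  inhabit A
  induction i generalizing x with
  | zero => exact ⟨fun _ => default, by simpa [orbit, orbits, eq_comm] using hx⟩
  | succ i ih =>
    obtain ⟨y, hy, a, rfl⟩ := (mem_orbits_succ x₀ δ).1 hx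
    obtain ⟨u, rfl⟩ := ih hy
    have key : ∀ j ≤ i, orbit x₀ δ (Function.update u i a) j = orbit x₀ δ u j := by
      intro j
      induction j with
      | zero => intro _; rfl
      | succ j ihj =>
        intro hj
        simp only [orbit]
        rw [ihj (by omega), Function.update_of_ne (by omega)]
    refine ⟨Function.update u i a, ?_⟩
    simp only [orbit]
    rw [key i le_rfl, Function.update_self]

theorem orbits_nonempty [Nonempty A] (i : ℕ) : (orbits x₀ δ i).Nonempty := by
  inhabit A
  exact ⟨_, orbit_mem_orbits x₀ δ (fun _ => default) i⟩

variable [LinearOrder A]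

open scoped Classical in
/-- The pairs of a state number and a letter that lead to `x`. -/
noncomputable def preds (num : S → ℕ) (i : ℕ) (x : S) : Finset (ℕ ×ₗ A) :=
  ((orbits x₀ δ i ×ˢ (Finset.univ : Finset A)).filter fun t => δ i t.1 t.2 = x).image
    fun t => toLex (num t.1, t.2)

theorem mem_preds {num : S → ℕ} {i : ℕ} {x : S} {p : ℕ} {a : A} :
    toLex (p, a) ∈ preds x₀ δ num i x ↔ ∃ y ∈ orbits x₀ δ i, num y = p ∧ δ i y a = x := by
  classical
  simp only [preds, Finset.mem_image, Finset.mem_filter, Finset.mem_product, Finset.mem_univ,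
    and_true, Prod.exists]
  constructor
  · rintro ⟨y, b, ⟨hy, rfl⟩, h⟩
    have h := Prod.ext_iff.1 (toLex.injective h)
    obtain ⟨h1, h2⟩ := h
    simp only at h1 h2
    subst h1 h2
    exact ⟨y, hy, rfl, rfl⟩
  · rintro ⟨y, hy, rfl, rfl⟩
    exact ⟨y, a, ⟨hy, rfl⟩, rfl⟩

/-- The states of every level are numbered in the order of their least predecessors. -/
noncomputable def number : ℕ → S → ℕ
  | 0 => fun _ => 0
  | i + 1 => rank (orbits x₀ δ (i + 1)) fun x => (preds x₀ δ (number i) i x).min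

theorem preds_nonempty {i : ℕ} {x : S} (hx : x ∈ orbits x₀ δ (i + 1)) :
    (preds x₀ δ (number x₀ δ i) i x).Nonempty := by
  obtain ⟨y, hy, a, h⟩ := (mem_orbits_succ x₀ δ).1 hx
  exact ⟨toLex (number x₀ δ i y, a), (mem_preds x₀ δ).2 ⟨y, hy, rfl, h⟩⟩

/-- The least pair `(p, a)` already determines its target: `p` is the number of a unique state, and
`δ` is a function. Nonemptiness rules out the value `⊤`. -/
theorem min_preds_injOn {i : ℕ} (h : Set.InjOn (number x₀ δ i) (orbits x₀ δ i)) :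
    Set.InjOn (fun x => (preds x₀ δ (number x₀ δ i) i x).min) (orbits x₀ δ (i + 1)) := by
  intro x hx x' hx' hxx
  obtain ⟨m, hm⟩ := Finset.min_of_nonempty (preds_nonempty x₀ δ hx)
  have h1 := Finset.mem_of_min hm
  have h2 := Finset.mem_of_min (hxx.symm.trans hm)
  obtain ⟨p, a⟩ := m
  obtain ⟨y, hy, hp, rfl⟩ := (mem_preds x₀ δ).1 h1
  obtain ⟨y', hy', hp', rfl⟩ := (mem_preds x₀ δ).1 h2
  rw [h hy hy' (hp.trans hp'.symm)]

theorem number_injOn (i : ℕ) : Set.InjOn (number x₀ δ i) (orbits x₀ δ i) := by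
  induction i with
  | zero =>
    intro x hx y hy _
    simp only [orbits, Finset.coe_singleton, Set.mem_singleton_iff] at hx hy
    rw [hx, hy]
  | succ i ih => exact rank_injOn (min_preds_injOn x₀ δ ih)

theorem number_inj {i : ℕ} {x y : S} (hx : x ∈ orbits x₀ δ i) (hy : y ∈ orbits x₀ δ i) :
    number x₀ δ i x = number x₀ δ i y ↔ x = y :=
  (number_injOn x₀ δ i).eq_iff hx hy

theorem image_number (i : ℕ) :
    (orbits x₀ δ i).image (number x₀ δ i) = Finset.range (orbits x₀ δ i).card := by
  cases i with
  | zero => rfl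
  | succ i => exact image_rank (min_preds_injOn x₀ δ (number_injOn x₀ δ i))

theorem number_mem {i : ℕ} {x : S} (hx : x ∈ orbits x₀ δ i) :
    number x₀ δ i x ∈ Finset.range (orbits x₀ δ i).card :=
  image_number x₀ δ i ▸ Finset.mem_image_of_mem _ hx

theorem exists_number_eq {i q : ℕ} (hq : q ∈ Finset.range (orbits x₀ δ i).card) :
    ∃ x ∈ orbits x₀ δ i, number x₀ δ i x = q :=
  Finset.mem_image.1 (image_number x₀ δ i ▸ hq)

variable (acc : Set S) (k : ℕ)

open scoped Classical in
/-- The layers of the ODD of length `k` with the numbered states of the transition system. -/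
noncomputable def systemLayer (i : ℕ) : Layer A where
  left := Finset.range (orbits x₀ δ i).card
  right := Finset.range (orbits x₀ δ (i + 1)).card
  trans := (orbits x₀ δ i ×ˢ (Finset.univ : Finset A)).image fun t =>
    (number x₀ δ i t.1, t.2, number x₀ δ (i + 1) (δ i t.1 t.2))
  init := if i = 0 then Finset.range (orbits x₀ δ i).card else ∅
  final := if i + 1 = k then
    ((orbits x₀ δ (i + 1)).filter fun x => x ∈ acc).image (number x₀ δ (i + 1)) else ∅
  initFlag := decide (i = 0)
  finalFlag := decide (i + 1 = k)
  trans_mem := by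
    intro p a q h
    simp only [Finset.mem_image, Finset.mem_product, Finset.mem_univ, and_true, Prod.mk.injEq,
      Prod.exists] at h
    obtain ⟨y, b, hy, rfl, rfl, rfl⟩ := h
    exact ⟨number_mem x₀ δ hy, number_mem x₀ δ ((mem_orbits_succ x₀ δ).2 ⟨y, hy, b, rfl⟩)⟩
  init_subset := by split_ifs <;> simp
  final_subset := by
    split_ifs
    · intro q hq
      obtain ⟨x, hx, rfl⟩ := Finset.mem_image.1 hq
      exact number_mem x₀ δ (Finset.mem_filter.1 hx).1
    · simp
  init_eq_empty h := if_neg (of_decide_eq_false h)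
  final_eq_empty h := if_neg (of_decide_eq_false h)

theorem mem_systemLayer_trans {i p q : ℕ} {a : A} :
    (p, a, q) ∈ (systemLayer x₀ δ acc k i).trans ↔ ∃ y ∈ orbits x₀ δ i,
      number x₀ δ i y = p ∧ number x₀ δ (i + 1) (δ i y a) = q := by
  classical
  simp only [systemLayer, Finset.mem_image, Finset.mem_product, Finset.mem_univ, and_true,
    Prod.mk.injEq, Prod.exists]
  constructor
  · rintro ⟨y, b, hy, rfl, rfl, rfl⟩
    exact ⟨y, hy, rfl, rfl⟩
  · rintro ⟨y, hy, rfl, rfl⟩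
    exact ⟨y, a, hy, rfl, rfl, rfl⟩

theorem number_trans_iff {i q : ℕ} {a : A} {y : S} (hy : y ∈ orbits x₀ δ i) :
    (number x₀ δ i y, a, q) ∈ (systemLayer x₀ δ acc k i).trans ↔
      q = number x₀ δ (i + 1) (δ i y a) := by
  rw [mem_systemLayer_trans]
  constructor
  · rintro ⟨y', hy', h, rfl⟩
    rw [(number_inj x₀ δ hy' hy).1 h]
  · rintro rfl
    exact ⟨y, hy, rfl, rfl⟩

theorem number_mem_final_iff {x : S} (hk : 0 < k) (hx : x ∈ orbits x₀ δ k) :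
    number x₀ δ k x ∈ (systemLayer x₀ δ acc k (k - 1)).final ↔ x ∈ acc := by
  classical
  obtain ⟨k, rfl⟩ : ∃ j, k = j + 1 := ⟨k - 1, by omega⟩
  simp only [systemLayer, Nat.add_sub_cancel, if_true, Finset.mem_image, Finset.mem_filter]
  constructor
  · rintro ⟨x', ⟨hx', h⟩, hn⟩
    rwa [← (number_inj x₀ δ hx' hx).1 hn]
  · intro h
    exact ⟨x, ⟨hx, h⟩, rfl⟩

theorem systemLayer_isODDSeq (hk : 0 < k) : IsODDSeq (systemLayer x₀ δ acc k) k where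
  pos := hk
  left_succ _ _ := rfl
  initFlag i _ := by simp [systemLayer]
  finalFlag i _ := by simp [systemLayer]

theorem systemLayer_isDeterministic (i : ℕ) : (systemLayer x₀ δ acc k i).IsDeterministic := by
  constructor
  · intro h
    obtain rfl : i = 0 := by simpa [systemLayer] using h
    simp [systemLayer, orbits]
  · intro p hp a q _ q' _ h h'
    obtain ⟨y, hy, rfl⟩ := exists_number_eq x₀ δ hp
    rw [number_trans_iff x₀ δ acc k hy] at h h'
    rw [h, h']

theorem systemLayer_isComplete (i : ℕ) : (systemLayer x₀ δ acc k i).IsComplete := by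
  constructor
  · intro h
    obtain rfl : i = 0 := by simpa [systemLayer] using h
    simp [systemLayer, orbits]
  · intro p hp a
    obtain ⟨y, hy, rfl⟩ := exists_number_eq x₀ δ hp
    exact ⟨_, number_mem x₀ δ ((mem_orbits_succ x₀ δ).2 ⟨y, hy, a, rfl⟩),
      (number_trans_iff x₀ δ acc k hy).2 rfl⟩

theorem systemLayer_isReachable (i : ℕ) : (systemLayer x₀ δ acc k i).IsReachable := by
  intro q hq
  obtain ⟨x, hx, rfl⟩ := exists_number_eq x₀ δ hq
  obtain ⟨y, hy, a, rfl⟩ := (mem_orbits_succ x₀ δ).1 hx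
  exact ⟨a, _, number_mem x₀ δ hy, (number_trans_iff x₀ δ acc k hy).2 rfl⟩

theorem systemLayer_incoming {i : ℕ} {x : S} (hx : x ∈ orbits x₀ δ (i + 1)) :
    (systemLayer x₀ δ acc k i).incoming (number x₀ δ (i + 1) x) =
      preds x₀ δ (number x₀ δ i) i x := by
  ext ⟨p, a⟩
  refine Iff.trans ?_ (mem_preds x₀ δ).symm
  refine (mem_systemLayer_trans x₀ δ acc k).trans ?_
  refine exists_congr fun y => and_congr_right fun hy => and_congr_right fun _ => ?_
  exact number_inj x₀ δ ((mem_orbits_succ x₀ δ).2 ⟨y, hy, a, rfl⟩) hx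

theorem systemLayer_isNormalized [Nonempty A] (i : ℕ) : (systemLayer x₀ δ acc k i).IsNormalized := by
  refine ⟨⟨systemLayer_isReachable x₀ δ acc k i, systemLayer_isDeterministic x₀ δ acc k i, ?_⟩, _, _,
    (orbits_nonempty x₀ δ i).card_pos, (orbits_nonempty x₀ δ (i + 1)).card_pos, rfl, rfl⟩
  intro q hq q' hq' m m' hm hm'
  obtain ⟨x, hx, rfl⟩ := exists_number_eq x₀ δ hq
  obtain ⟨x', hx', rfl⟩ := exists_number_eq x₀ δ hq'
  rw [systemLayer_incoming x₀ δ acc k hx] at hm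
  rw [systemLayer_incoming x₀ δ acc k hx'] at hm'
  have key : ∀ (T : Finset (ℕ ×ₗ A)) (z : ℕ ×ₗ A), IsLeast (T : Set (ℕ ×ₗ A)) z → T.min = z := by
    intro T z hz
    exact le_antisymm (Finset.min_le hz.1)
      (Finset.le_min fun y hy => WithTop.coe_le_coe.2 (hz.2 hy))
  refine (rank_lt_rank_iff hx).trans ?_
  rw [key _ _ hm, key _ _ hm', WithTop.coe_lt_coe]

theorem systemLayer_isNormalizedSeq [Nonempty A] (hk : 0 < k) :
    IsNormalizedSeq (systemLayer x₀ δ acc k) k where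
  toIsODDSeq := systemLayer_isODDSeq x₀ δ acc k hk
  det i _ := systemLayer_isDeterministic x₀ δ acc k i
  complete i _ := systemLayer_isComplete x₀ δ acc k i
  normalized i _ := systemLayer_isNormalized x₀ δ acc k i

/-- Numbering is injective on each level, so it transports separation of states by successors and,
at level `k`, by acceptance. -/
theorem systemLayer_isReduced (hk : 0 < k)
    (hδ : ∀ i y y', (∀ a, δ i y a = δ i y' a) → y = y')
    (hacc : ∀ y ∈ orbits x₀ δ k, ∀ y' ∈ orbits x₀ δ k, (y ∈ acc ↔ y' ∈ acc) → y = y') (i : ℕ) :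
    (systemLayer x₀ δ acc k i).IsReduced := by
  constructor
  · intro p hp p' hp' h
    obtain ⟨y, hy, rfl⟩ := exists_number_eq x₀ δ hp
    obtain ⟨y', hy', rfl⟩ := exists_number_eq x₀ δ hp'
    rw [hδ i y y' fun a => ?_]
    have h1 := (h a _).1 ((number_trans_iff x₀ δ acc k hy).2 rfl)
    rw [number_trans_iff x₀ δ acc k hy'] at h1
    exact (number_inj x₀ δ ((mem_orbits_succ x₀ δ).2 ⟨y, hy, a, rfl⟩)
      ((mem_orbits_succ x₀ δ).2 ⟨y', hy', a, rfl⟩)).1 h1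
  · intro hf q hq q' hq' h
    obtain rfl : i + 1 = k := by simpa [systemLayer] using hf
    obtain ⟨y, hy, rfl⟩ := exists_number_eq x₀ δ hq
    obtain ⟨y', hy', rfl⟩ := exists_number_eq x₀ δ hq'
    rw [hacc y hy y' hy']
    have e1 := number_mem_final_iff x₀ δ acc (i + 1) hk hy
    have e2 := number_mem_final_iff x₀ δ acc (i + 1) hk hy'
    rw [Nat.add_sub_cancel] at e1 e2
    rw [← e1, ← e2, h]

theorem systemLayer_reach (u : ℕ → A) (i : ℕ) :
    reach (systemLayer x₀ δ acc k) u i = {number x₀ δ i (orbit x₀ δ u i)} := by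
  induction i with
  | zero => simp [systemLayer, orbits, number]
  | succ i ih =>
    ext q
    rw [reach_succ, ih, Layer.mem_next]
    simp only [Finset.mem_singleton, exists_eq_left]
    rw [number_trans_iff x₀ δ acc k (orbit_mem_orbits x₀ δ u i)]
    rfl

theorem systemLayer_acceptsSeq (hk : 0 < k) (u : ℕ → A) :
    AcceptsSeq (systemLayer x₀ δ acc k) k u ↔ orbit x₀ δ u k ∈ acc := by
  rw [AcceptsSeq, systemLayer_reach]
  simp only [Finset.mem_singleton, exists_eq_left]
  exact number_mem_final_iff x₀ δ acc k hk (orbit_mem_orbits x₀ δ u k)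

end System

/-! ### Residuals -/

/-- Every set of words that depends on the first `k` letters only has a reduced normalized ODD. -/
theorem exists_reduced_normalized [Fintype A] [Nonempty A] [LinearOrder A] {k : ℕ} (hk : 0 < k)
    (K : Set (ℕ → A)) (hK : ∀ u u' : ℕ → A, (∀ j < k, u j = u' j) → (u ∈ K ↔ u' ∈ K)) :
    ∃ C : ℕ → Layer A, IsNormalizedSeq C k ∧ (∀ i < k, (C i).IsReduced) ∧
      ∀ u, AcceptsSeq C k u ↔ u ∈ K := by
  -- States are residuals, kept as sets of full words: membership of `g` is tested after overwriting
  -- its first letters by those already read.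
  set δ : ℕ → Set (ℕ → A) → A → Set (ℕ → A) := fun i r a => {g | Function.update g i a ∈ r}
  have horb : ∀ u i, orbit K δ u i = {g | (fun j => if j < i then u j else g j) ∈ K} := by
    intro u i
    induction i with
    | zero => simp only [orbit, Nat.not_lt_zero, if_false]; rfl
    | succ i ih =>
      ext g
      change Function.update g i (u i) ∈ orbit K δ u i ↔ _
      rw [ih]
      refine iff_of_eq (congrArg (· ∈ K) (funext fun j => ?_))
      rcases lt_trichotomy j i with h | rfl | h
      · simp [h, Nat.lt_succ_of_lt h]
      · simp
      · simp [Function.update_of_ne h.ne', h.not_gt, show ¬ j < i + 1 by omega]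
  -- After `k` letters nothing relevant is left to read, so the residual is everything or empty;
  -- accepting means being nonempty.
  have horbk : ∀ u, orbit K δ u k = {_g | u ∈ K} := by
    intro u
    rw [horb]
    ext g
    exact hK _ _ fun j hj => by simp [hj]
  have hacc : ∀ u, orbit K δ u k ∈ {r : Set (ℕ → A) | r.Nonempty} ↔ u ∈ K := by
    intro u
    inhabit A
    rw [horbk]
    exact ⟨fun ⟨_, h⟩ => h, fun h => ⟨fun _ => default, h⟩⟩
  refine ⟨systemLayer K δ {r | r.Nonempty} k, systemLayer_isNormalizedSeq _ _ _ _ hk,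
    fun i _ => systemLayer_isReduced _ _ _ _ hk ?_ ?_ i, fun u => ?_⟩
  -- Overwriting position `i` of `g` by `g i` changes nothing, so the successors of any set,
  -- reachable or not, determine it.
  · intro i y y' h
    ext g
    have := Set.ext_iff.1 (h (g i)) g
    change Function.update g i (g i) ∈ y ↔ Function.update g i (g i) ∈ y' at this
    rwa [Function.update_eq_self] at this
  · intro y hy y' hy' h
    obtain ⟨u, rfl⟩ := exists_orbit_eq K δ hy
    obtain ⟨u', rfl⟩ := exists_orbit_eq K δ hy'
    rw [hacc, hacc] at h
    rw [horbk, horbk]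
    simp only [h]
  · rw [systemLayer_acceptsSeq _ _ _ _ hk, hacc]

/-! ### Canonical forms -/

/-- A normalized reduced ODD equivalent to `D`. -/
structure IsReducedForm [LinearOrder A] (D C : List (Layer A)) : Prop where
  length_eq : C.length = D.length
  normalizedSeq : IsNormalizedSeq (seq C) D.length
  reduced : ∀ i < D.length, (seq C i).IsReduced
  accepts : ∀ u, AcceptsSeq (seq C) D.length u ↔ AcceptsSeq (seq D) D.length u

theorem IsReducedForm.ne_nil [LinearOrder A] {D C : List (Layer A)}
    (h : IsReducedForm D C) : C ≠ [] :=
  List.length_pos_iff.1 (h.length_eq ▸ h.normalizedSeq.pos)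

theorem IsReducedForm.ne_nil' [LinearOrder A] {D C : List (Layer A)}
    (h : IsReducedForm D C) : D ≠ [] :=
  List.length_pos_iff.1 h.normalizedSeq.pos

section

variable [Nonempty A]

theorem exists_isReducedForm [Fintype A] [LinearOrder A] {D : List (Layer A)} (hD : IsODD D) :
    ∃ C, IsReducedForm D C := by
  rw [isODD_iff] at hD
  obtain ⟨B, hB, hr, hacc⟩ := exists_reduced_normalized hD.pos
    {u | AcceptsSeq (seq D) D.length u} fun u u' h => acceptsSeq_congr_word _ h
  have hs : ∀ i < D.length, seq ((List.range D.length).map B) i = B i :=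
    fun i hi => seq_map_range B hi
  refine ⟨(List.range D.length).map B, by simp, ⟨⟨hB.toIsODDSeq.congr hs, ?_, ?_⟩, ?_⟩, ?_, ?_⟩
  · intro i hi
    rw [hs i hi]
    exact hB.det i hi
  · intro i hi
    rw [hs i hi]
    exact hB.complete i hi
  · intro i hi
    rw [hs i hi]
    exact hB.normalized i hi
  · intro i hi
    rw [hs i hi]
    exact hr i hi
  · intro u
    refine Iff.trans ?_ (hacc u)
    rw [AcceptsSeq, AcceptsSeq, reach_congr_seq u hD.pos le_rfl hs,
      hs _ (Nat.sub_lt hD.pos one_pos)]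

namespace IsReducedForm

variable [LinearOrder A] {D C C' : List (Layer A)}

theorem lang_eq (h : IsReducedForm D C) : lang C = lang D := by
  rw [lang_eq_iff h.ne_nil h.ne_nil', h.length_eq]
  exact ⟨rfl, h.accepts⟩

theorem isMinimized (h : IsReducedForm D C) : IsMinimized C := by
  intro w _ D' hD' hlang
  have hne : D' ≠ [] := hD'.1.1
  obtain ⟨hl, hacc⟩ := (lang_eq_iff hne h.ne_nil).1 hlang
  have hl' : D'.length = D.length := hl.trans h.length_eq
  have hB : IsCDSeq (seq D') D.length := by
    have h1 := isODD_iff.1 hD'.1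
    have h2 := forall_mem_iff_seq.1 hD'.2
    rw [hl'] at h1 h2
    exact ⟨h1, fun i hi => (h2 i hi).2.1, fun i hi => (h2 i hi).2.2⟩
  rw [numStates_eq hne, numStates_eq h.ne_nil, hl]
  refine Finset.sum_le_sum fun i hi => ?_
  rw [Finset.mem_range, h.length_eq] at hi
  refine card_level_le h.normalizedSeq.toIsCDSeq h.normalizedSeq.reachable h.reduced
    (fun u => ?_) hB (by omega)
  rw [← hl', hacc u]

theorem isCanonicalForm (h : IsReducedForm D C) : IsCanonicalForm D C := by
  have hN := h.normalizedSeq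
  refine ⟨?_, ?_, ?_, h.isMinimized, ?_, h.lang_eq⟩
  · rw [isODD_iff, h.length_eq]
    exact hN.toIsODDSeq
  · rw [forall_mem_iff_seq, h.length_eq]
    exact hN.det
  · rw [forall_mem_iff_seq, h.length_eq]
    exact hN.complete
  · rw [forall_mem_iff_seq, h.length_eq]
    exact hN.normalized

/-- Minimality of `C'` bounds its total by that of `C`, while `C` is smallest at each level; hence
the levels have equal sizes and `seq_eq_of_card_eq` applies. -/
theorem eq_of_isCanonicalForm (h : IsReducedForm D C) (h' : IsCanonicalForm D C') : C' = C := by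
  obtain ⟨hodd, hdet, hcomp, hmin, hnorm, hlang⟩ := h'
  have hne : C' ≠ [] := hodd.1
  obtain ⟨hl, hacc⟩ := (lang_eq_iff hne h.ne_nil').1 hlang
  rw [isODD_iff, hl] at hodd
  rw [forall_mem_iff_seq, hl] at hdet hcomp hnorm
  rw [hl] at hacc
  have hB : IsNormalizedSeq (seq C') D.length := ⟨⟨hodd, hdet, hcomp⟩, hnorm⟩
  have hL : ∀ u, AcceptsSeq (seq C) D.length u ↔ AcceptsSeq (seq C') D.length u := fun u =>
    (h.accepts u).trans (hacc u).symm
  have hle : ∀ i ∈ Finset.range (D.length + 1),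
      (level (seq C) i).card ≤ (level (seq C') i).card := fun i hi =>
    card_level_le h.normalizedSeq.toIsCDSeq h.normalizedSeq.reachable h.reduced hL hB.toIsCDSeq
      (Nat.lt_succ_iff.1 (Finset.mem_range.1 hi))
  have hCcd : ∃ w, 1 ≤ w ∧ C ∈ cdOdds A w := by
    -- Minimality is tested against ODDs of some positive width; one more than the total number of
    -- states is wide enough.
    refine ⟨1 + ∑ i ∈ Finset.range (D.length + 1), (level (seq C) i).card, by omega, ?_, ?_⟩
    · rw [isODD_iff, h.length_eq]
      exact h.normalizedSeq.toIsODDSeq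
    · rw [forall_mem_iff_seq, h.length_eq]
      intro i hi
      have hsub : ∀ j ≤ D.length, level (seq C) j ⊆
          Finset.range (1 + ∑ i ∈ Finset.range (D.length + 1), (level (seq C) i).card) := by
        intro j hj
        rw [h.normalizedSeq.level_eq_range hj]
        refine Finset.range_subset_range.2 (le_add_left ?_)
        exact Finset.single_le_sum (f := fun i => (level (seq C) i).card)
          (fun _ _ => Nat.zero_le _) (Finset.mem_range.2 (by omega))
      refine ⟨⟨?_, hsub (i + 1) hi⟩, h.normalizedSeq.det i hi, h.normalizedSeq.complete i hi⟩
      rw [h.normalizedSeq.left_eq hi]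
      exact hsub i hi.le
  obtain ⟨w, hw, hCw⟩ := hCcd
  have hsum := hmin w hw C hCw (h.lang_eq.trans hlang.symm)
  rw [numStates_eq hne, numStates_eq h.ne_nil, hl, h.length_eq] at hsum
  have heq := (Finset.sum_eq_sum_iff_of_le hle).1 (le_antisymm (Finset.sum_le_sum hle) hsum)
  refine ext_seq (hl.trans h.length_eq.symm) fun i hi => ?_
  rw [hl] at hi
  exact seq_eq_of_card_eq h.normalizedSeq h.reduced hL hB
    (fun j hj => (heq j (Finset.mem_range.2 (by omega))).symm) hi

end IsReducedForm

/-- This trades global minimality for reducedness, which an automaton can check one layer at a time.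
-/
theorem isCanonicalForm_iff [Fintype A] [LinearOrder A] {D C : List (Layer A)} (hD : IsODD D) :
    IsCanonicalForm D C ↔ IsReducedForm D C := by
  refine ⟨fun h => ?_, IsReducedForm.isCanonicalForm⟩
  obtain ⟨C₀, hC₀⟩ := exists_isReducedForm hD
  rwa [hC₀.eq_of_isCanonicalForm h]

theorem isCanonicalForm_unique [Fintype A] [LinearOrder A] {D C C' : List (Layer A)}
    (hD : IsODD D) (h : IsCanonicalForm D C) (h' : IsCanonicalForm D C') : C = C' :=
  ((isCanonicalForm_iff hD).1 h').eq_of_isCanonicalForm h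

end

/-! ### Runs of finite automata -/

theorem mem_evalFrom_iff_exists_run {α : Type u} {σ : Type v} (M : NFA α σ) (S : Set σ)
    (x : List α) (q : σ) : q ∈ M.evalFrom S x ↔ ∃ f : ℕ → σ, f 0 ∈ S ∧
      (∀ (i : ℕ) (h : i < x.length), f (i + 1) ∈ M.step (f i) x[i]) ∧ f x.length = q := by
  induction x generalizing S with
  | nil =>
    constructor
    · intro h
      exact ⟨fun _ => q, h, by simp, rfl⟩
    · rintro ⟨f, h, -, rfl⟩
      exact h
  | cons a x ih =>
    change q ∈ M.evalFrom (M.stepSet S a) x ↔ _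
    rw [ih]
    constructor
    · rintro ⟨f, h0, h1, rfl⟩
      obtain ⟨p, hp, hpf⟩ := (M.mem_stepSet).1 h0
      refine ⟨fun i => Nat.casesOn i p f, hp, fun i hi => ?_, rfl⟩
      cases i with
      | zero => exact hpf
      | succ i => exact h1 i (by simpa using hi)
    · rintro ⟨f, h0, h1, rfl⟩
      refine ⟨fun i => f (i + 1), ?_, fun i hi => ?_, rfl⟩
      · exact (M.mem_stepSet).2 ⟨f 0, h0, h1 0 (by simp)⟩
      · exact h1 (i + 1) (by simpa using hi)

theorem mem_accepts_iff_exists_run {α : Type u} {σ : Type v} (M : NFA α σ) (x : List α) :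
    x ∈ M.accepts ↔ ∃ f : ℕ → σ, f 0 ∈ M.start ∧
      (∀ (i : ℕ) (h : i < x.length), f (i + 1) ∈ M.step (f i) x[i]) ∧ f x.length ∈ M.accept := by
  constructor
  · rintro ⟨q, hq, h⟩
    obtain ⟨f, h0, h1, rfl⟩ := (mem_evalFrom_iff_exists_run M _ x q).1 h
    exact ⟨f, h0, h1, hq⟩
  · rintro ⟨f, h0, h1, h2⟩
    exact ⟨_, h2, (mem_evalFrom_iff_exists_run M _ x _).2 ⟨f, h0, h1, rfl⟩⟩

/-! ### The automaton of the canonization -/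

/-- What the automaton remembers after reading the first layers of `D` and `C`: the right states
of `D`, the number of right states of `C`, a relation between the sets of states of `D` and the
states of `C` reached by the same words, and the phase: `0` at the beginning, `2` after the last
layer, `1` in between. -/
structure Config where
  states : Finset ℕ
  width : ℕ
  sim : Finset ℕ → ℕ → Prop
  phase : ℕ

/-- The automaton may pass from `s` to `t` when it reads the layer `L` of `D` and the layer `M` of
`C`. -/
structure Config.Step [LinearOrder A] (K : Set (Layer A)) (m : ℕ) (s t : Config) (L M : Layer A) :
    Prop where
  mem_left : L ∈ K
  mem_right : M ∈ cdLayers A m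
  normalized : M.IsNormalized
  reduced : M.IsReduced
  phase_lt : s.phase < 2
  phase_pos : 0 < t.phase
  left_eq : 0 < s.phase → L.left = s.states ∧ M.left = Finset.range s.width
  right_eq : L.right = t.states ∧ M.right = Finset.range t.width
  initFlag : (L.initFlag = true ↔ s.phase = 0) ∧ (M.initFlag = true ↔ s.phase = 0)
  finalFlag : (L.finalFlag = true ↔ t.phase = 2) ∧ (M.finalFlag = true ↔ t.phase = 2)
  start : s.phase = 0 → ∀ q ∈ M.init, s.sim L.init q
  sim : ∀ S q a q', s.sim S q → (q, a, q') ∈ M.trans → t.sim (L.next S a) q'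
  final : t.phase = 2 → ∀ S q, t.sim S q → ((∃ p ∈ S, p ∈ L.final) ↔ q ∈ M.final)

section Run

variable [LinearOrder A] {K : Set (Layer A)} {m k : ℕ} {B C : ℕ → Layer A} {f : ℕ → Config}

/-- An accepting run on the first `k` layers of `B` and `C`. -/
structure IsAcceptingRun (K : Set (Layer A)) (m k : ℕ) (B C : ℕ → Layer A) (f : ℕ → Config) :
    Prop where
  phase_zero : (f 0).phase = 0
  step : ∀ i < k, Config.Step K m (f i) (f (i + 1)) (B i) (C i)
  phase_last : (f k).phase = 2

namespace IsAcceptingRun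

theorem pos (h : IsAcceptingRun K m k B C f) : 0 < k := by
  rcases Nat.eq_zero_or_pos k with rfl | hk
  · exact absurd (h.phase_zero.symm.trans h.phase_last) (by decide)
  · exact hk

theorem phase_eq_zero_iff (h : IsAcceptingRun K m k B C f) {i : ℕ} (hi : i < k) :
    (f i).phase = 0 ↔ i = 0 := by
  cases i with
  | zero => simp [h.phase_zero]
  | succ i => simpa using (h.step i (by omega)).phase_pos.ne'

theorem phase_eq_two_iff (h : IsAcceptingRun K m k B C f) {i : ℕ} (hi : i ≤ k) :
    (f i).phase = 2 ↔ i = k := by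
  constructor
  · intro h2
    by_contra hne
    have := (h.step i (by omega)).phase_lt
    omega
  · rintro rfl
    exact h.phase_last

theorem isODDSeq_left (h : IsAcceptingRun K m k B C f) : IsODDSeq B k where
  pos := h.pos
  left_succ i hi := by
    rw [(h.step i (by omega)).right_eq.1,
      ((h.step (i + 1) hi).left_eq (h.step i (by omega)).phase_pos).1]
  initFlag i hi := by rw [(h.step i hi).initFlag.1, h.phase_eq_zero_iff hi]
  finalFlag i hi := by rw [(h.step i hi).finalFlag.1, h.phase_eq_two_iff hi]

theorem isNormalizedSeq_right (h : IsAcceptingRun K m k B C f) : IsNormalizedSeq C k where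
  pos := h.pos
  left_succ i hi := by
    rw [(h.step i (by omega)).right_eq.2,
      ((h.step (i + 1) hi).left_eq (h.step i (by omega)).phase_pos).2]
  initFlag i hi := by rw [(h.step i hi).initFlag.2, h.phase_eq_zero_iff hi]
  finalFlag i hi := by rw [(h.step i hi).finalFlag.2, h.phase_eq_two_iff hi]
  det i hi := (h.step i hi).mem_right.2.1
  complete i hi := (h.step i hi).mem_right.2.2
  normalized i hi := (h.step i hi).normalized

/-- Soundness: a guessed relation may be too large, but closure under letters makes it contain every
pair reached by a word, which suffices for equivalence. -/
theorem sim_reach (h : IsAcceptingRun K m k B C f) (u : ℕ → A) {i : ℕ} (hi : i ≤ k) :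
    (f i).sim (reach B u i) (run C u i) := by
  have hC := h.isNormalizedSeq_right.toIsCDSeq
  induction i with
  | zero =>
    refine (h.step 0 h.pos).start h.phase_zero _ ?_
    rw [← reach_zero C u, hC.reach_eq u hi]
    exact Finset.mem_singleton_self _
  | succ i ih => exact (h.step i hi).sim _ _ _ _ (ih (by omega)) ((hC.run_trans u hi).2 rfl)

theorem accepts_iff (h : IsAcceptingRun K m k B C f) (u : ℕ → A) :
    AcceptsSeq C k u ↔ AcceptsSeq B k u := by
  rw [h.isNormalizedSeq_right.acceptsSeq_iff]
  have hk : k - 1 + 1 = k := Nat.sub_add_cancel h.pos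
  have hstep := h.step (k - 1) (by have := h.pos; omega)
  rw [hk] at hstep
  exact (hstep.final h.phase_last _ _ (h.sim_reach u le_rfl)).symm

end IsAcceptingRun

/-- The configuration after `i` layers of the canonical run. -/
def canonicalConfig (k : ℕ) (B C : ℕ → Layer A) (i : ℕ) : Config where
  states := level B i
  width := (level C i).card
  sim S q := ∃ u, reach B u i = S ∧ run C u i = q
  phase := if i = 0 then 0 else if i = k then 2 else 1

/-- Completeness: guessing exactly the pairs reached by words satisfies every condition on a run. -/
theorem canonicalConfig_isAcceptingRun [Nonempty A] (hB : IsODDSeq B k) (hK : ∀ i < k, B i ∈ K)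
    (hC : IsNormalizedSeq C k) (hm : ∀ i < k, C i ∈ cdLayers A m)
    (hr : ∀ i < k, (C i).IsReduced) (hL : ∀ u, AcceptsSeq C k u ↔ AcceptsSeq B k u) :
    IsAcceptingRun K m k B C (canonicalConfig k B C) where
  phase_zero := rfl
  phase_last := by simp [canonicalConfig, hB.pos.ne']
  step i hi :=
    { mem_left := hK i hi
      mem_right := hm i hi
      normalized := hC.normalized i hi
      reduced := hr i hi
      phase_lt := by
        simp only [canonicalConfig, hi.ne, if_false]
        split_ifs <;> simp
      phase_pos := by
        simp only [canonicalConfig]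
        split_ifs <;> simp_all
      left_eq := fun _ => ⟨hB.left_eq hi, (hC.left_eq hi).trans (hC.level_eq_range hi.le)⟩
      right_eq := ⟨rfl, hC.level_eq_range (i := i + 1) hi⟩
      initFlag := by
        rw [hB.initFlag i hi, hC.initFlag i hi]
        simp only [canonicalConfig, hi.ne, if_false]
        split_ifs <;> simp_all
      finalFlag := by
        rw [hB.finalFlag i hi, hC.finalFlag i hi]
        simp only [canonicalConfig]
        split_ifs <;> simp_all
      start := by
        intro h0 q hq
        obtain rfl : i = 0 := by
          by_contra hne
          simp only [canonicalConfig, hne, if_false, hi.ne] at h0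
          exact absurd h0 one_ne_zero
        inhabit A
        refine ⟨fun _ => default, rfl, ?_⟩
        rw [← reach_zero C fun _ => default, hC.reach_eq _ hi.le, Finset.mem_singleton] at hq
        exact hq.symm
      sim := by
        rintro S q a q' ⟨u, rfl, rfl⟩ ht
        exact ⟨Function.update u i a, reach_update_succ B u i a,
          ((hC.run_trans_update u hi).1 ht).symm⟩
      final := by
        intro h2 S q
        have hik : i + 1 = k := by
          by_contra hne
          simp [canonicalConfig, hne] at h2
        rintro ⟨u, rfl, rfl⟩
        have := hL u
        rw [hC.acceptsSeq_iff, AcceptsSeq] at this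
        subst hik
        exact this.symm }

end Run

/-! ### Encoding by finitely many states -/

/-- The codes of configurations. -/
abbrev Code (w : ℕ) (P : Finset (Finset ℕ)) : Type :=
  (Finset.range w).powerset × Fin (P.card + 1) × (P → Option (Fin P.card)) × Fin 3

/-- Coding the relation as a partial function gives `(|P| + 1) ^ |P|` choices, where arbitrary
relations between `P` and `|P|` states would give `2 ^ (|P| ^ 2)`. -/
theorem card_code (w : ℕ) (P : Finset (Finset ℕ)) :
    Fintype.card (Code w P) = 3 * 2 ^ w * (P.card + 1) ^ (P.card + 1) := by
  simp only [Code, Fintype.card_prod, Fintype.card_coe, Finset.card_powerset, Finset.card_range,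
    Fintype.card_fin, Fintype.card_fun, Fintype.card_option]
  ring

/-- The configuration with a given code. -/
def Code.config {w : ℕ} {P : Finset (Finset ℕ)} (c : Code w P) : Config where
  states := c.1
  width := c.2.1
  sim S q := ∃ (hS : S ∈ P) (x : Fin P.card), c.2.2.1 ⟨S, hS⟩ = some x ∧ (x : ℕ) = q
  phase := c.2.2.2

theorem exists_code {w : ℕ} {P : Finset (Finset ℕ)} (s : Config)
    (h1 : s.states ⊆ Finset.range w) (h2 : s.width ≤ P.card)
    (h3 : ∀ S q, s.sim S q → S ∈ P ∧ q < P.card)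
    (h4 : ∀ S q q', s.sim S q → s.sim S q' → q = q') (h5 : s.phase < 3) :
    ∃ c : Code w P, c.config = s := by
  classical
  refine ⟨⟨⟨s.states, Finset.mem_powerset.2 h1⟩, ⟨s.width, Nat.lt_succ_of_le h2⟩,
    fun S => if h : ∃ q, s.sim S q then some ⟨h.choose, (h3 _ _ h.choose_spec).2⟩ else none,
    ⟨s.phase, h5⟩⟩, ?_⟩
  obtain ⟨S, n, R, p⟩ := s
  simp only [Code.config, Config.mk.injEq, true_and, and_true]
  funext S q
  refine propext ⟨?_, fun h => ?_⟩
  · rintro ⟨hS, x, hx, rfl⟩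
    split_ifs at hx with h
    rw [← Option.some.inj hx]
    exact h.choose_spec
  · have hex : ∃ q, R S q := ⟨q, h⟩
    refine ⟨(h3 _ _ h).1, _, dif_pos hex, h4 _ _ _ hex.choose_spec h⟩

/-- The automaton that checks whether `C` is the canonical form of `D`. -/
def canonizer [LinearOrder A] (K : Set (Layer A)) (w : ℕ) (P : Finset (Finset ℕ)) :
    NFA (Layer A × Layer A) (Code w P) where
  step c x := {c' | Config.Step K P.card c.config c'.config x.1 x.2}
  start := {c | c.config.phase = 0}
  accept := {c | c.config.phase = 2}

theorem mem_canonizer_accepts [LinearOrder A] {K : Set (Layer A)} {w : ℕ} {P : Finset (Finset ℕ)}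
    {z : List (Layer A × Layer A)} :
    z ∈ (canonizer K w P).accepts ↔ ∃ f : ℕ → Code w P,
      IsAcceptingRun K P.card z.length (seq (z.map Prod.fst)) (seq (z.map Prod.snd))
        fun i => (f i).config := by
  rw [mem_accepts_iff_exists_run]
  have hs : ∀ (i : ℕ) (h : i < z.length), seq (z.map Prod.fst) i = z[i].1 ∧
      seq (z.map Prod.snd) i = z[i].2 := fun i h => by
    rw [seq_eq_getElem _ (by simpa using h), seq_eq_getElem _ (by simpa using h)]
    simp
  constructor
  · rintro ⟨f, h0, h1, h2⟩
    refine ⟨f, h0, fun i hi => ?_, h2⟩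
    rw [(hs i hi).1, (hs i hi).2]
    exact h1 i hi
  · rintro ⟨f, h0, h1, h2⟩
    refine ⟨f, h0, fun i hi => ?_, h2⟩
    have := h1 i hi
    rw [(hs i hi).1, (hs i hi).2] at this
    exact this

/-- The canonization of the ODDs with layers in `K` is regular, provided that the sets of states
reached by words lie in `P`. -/
theorem isRegularTransduction_canonical [Fintype A] [Nonempty A] [LinearOrder A]
    {K : Set (Layer A)} {w : ℕ} {P : Finset (Finset ℕ)} (hK : K ⊆ layers A w)
    (hP : ∀ (B : ℕ → Layer A) (k : ℕ), IsODDSeq B k → (∀ i < k, B i ∈ K) →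
      ∀ u, ∀ i ≤ k, reach B u i ∈ P) :
    IsRegularTransduction K (cdLayers A P.card) (3 * 2 ^ w * (P.card + 1) ^ (P.card + 1))
      {x | (IsODD x.1 ∧ ∀ L ∈ x.1, L ∈ K) ∧ IsCanonicalForm x.1 x.2} := by
  have hcard : ∀ D C : List (Layer A), IsODD D → (∀ L ∈ D, L ∈ K) → IsReducedForm D C →
      ∀ i ≤ D.length, (level (seq C) i).card ≤ P.card := by
    intro D C hD hDK h i hi
    exact card_level_le_of_reach_mem h.normalizedSeq.toIsCDSeq h.normalizedSeq.reachable h.reduced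
      h.accepts hi fun u => hP _ _ (isODD_iff.1 hD) (forall_mem_iff_seq.1 hDK) u i hi
  have hcd : ∀ D C : List (Layer A), IsODD D → (∀ L ∈ D, L ∈ K) → IsReducedForm D C →
      ∀ i < D.length, seq C i ∈ cdLayers A P.card := by
    intro D C hD hDK h i hi
    have hsub : ∀ j ≤ D.length, level (seq C) j ⊆ Finset.range P.card := by
      intro j hj
      rw [h.normalizedSeq.level_eq_range hj]
      exact Finset.range_subset_range.2 (hcard D C hD hDK h j hj)
    refine ⟨⟨?_, hsub (i + 1) hi⟩, h.normalizedSeq.det i hi, h.normalizedSeq.complete i hi⟩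
    rw [h.normalizedSeq.left_eq hi]
    exact hsub i hi.le
  refine ⟨?_, Code w P, inferInstance, canonizer K w P, (card_code w P).le, ?_, ?_⟩
  · rintro ⟨D, C⟩ ⟨⟨hD, hDK⟩, hC⟩
    have h := (isCanonicalForm_iff hD).1 hC
    refine ⟨h.ne_nil', h.ne_nil, h.length_eq.symm, hDK, ?_⟩
    rw [forall_mem_iff_seq, h.length_eq]
    exact hcd D C hD hDK h
  · rintro c x ⟨c', h⟩
    exact ⟨h.mem_left, h.mem_right⟩
  · ext z
    rw [mem_canonizer_accepts]
    constructor
    · rintro ⟨f, hf⟩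
      have hlen : (z.map Prod.fst).length = z.length := List.length_map _
      have hD : IsODD (z.map Prod.fst) := by
        rw [isODD_iff, hlen]
        exact hf.isODDSeq_left
      refine ⟨(z.map Prod.fst, z.map Prod.snd), ⟨⟨hD, ?_⟩, ?_⟩, ?_⟩
      · rw [forall_mem_iff_seq, hlen]
        exact fun i hi => (hf.step i hi).mem_left
      · rw [isCanonicalForm_iff hD]
        refine ⟨by simp, ?_, ?_, ?_⟩ <;> rw [hlen]
        · exact hf.isNormalizedSeq_right
        · exact fun i hi => (hf.step i hi).reduced
        · exact hf.accepts_iff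
      · exact List.zip_of_prod rfl rfl
    · rintro ⟨⟨D, C⟩, ⟨⟨hD, hDK⟩, hC⟩, rfl⟩
      have h := (isCanonicalForm_iff hD).1 hC
      have hl : (D.zip C).length = D.length := by simp [h.length_eq]
      simp only [hl, List.map_fst_zip h.length_eq.ge, List.map_snd_zip h.length_eq.le]
      have hB := isODD_iff.1 hD
      have hBK := forall_mem_iff_seq.1 hDK
      have hrun := canonicalConfig_isAcceptingRun hB hBK h.normalizedSeq (hcd D C hD hDK h)
        h.reduced h.accepts
      have hcode : ∀ i, i ≤ D.length → ∃ c : Code w P,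
          c.config = canonicalConfig D.length (seq D) (seq C) i := by
        intro i hi
        refine exists_code _ ?_ (hcard D C hD hDK h i hi) ?_ ?_ ?_
        · cases i with
          | zero => exact (hK (hBK 0 hB.pos)).1
          | succ i => exact (hK (hBK i hi)).2
        · rintro S q ⟨u, rfl, rfl⟩
          refine ⟨hP _ _ hB hBK u i hi, ?_⟩
          have := h.normalizedSeq.run_mem u hi
          rw [h.normalizedSeq.level_eq_range hi, Finset.mem_range] at this
          exact this.trans_le (hcard D C hD hDK h i hi)
        -- Reducedness makes the exact relation functional, hence codable.
        · rintro S q q' ⟨u, rfl, rfl⟩ ⟨u', hu, rfl⟩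
          exact run_eq_of_reach_eq h.normalizedSeq.toIsCDSeq h.reduced h.accepts hi hu.symm
        · simp only [canonicalConfig]
          split_ifs <;> simp
      have : Nonempty (Code w P) := ⟨(hcode 0 (Nat.zero_le _)).choose⟩
      choose! f hf using hcode
      refine ⟨f, ?_, fun i hi => ?_, ?_⟩
      · rw [hf 0 (Nat.zero_le _)]
        exact hrun.phase_zero
      · rw [hf i hi.le, hf (i + 1) hi]
        exact hrun.step i hi
      · rw [hf _ le_rfl]
        exact hrun.phase_last

/-! ### Counting -/

/-- The exponent is at most `2 + w + (w + 1)(2 ^ w + 1)`, where `2 + w` costs `3` and the product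
`4` multiples of `w * 2 ^ w`. -/
theorem card_powerset_bound {w : ℕ} (hw : 1 ≤ w) :
    3 * 2 ^ w * (2 ^ w + 1) ^ (2 ^ w + 1) ≤ 2 ^ (7 * (w * 2 ^ w)) := by
  have h1 : 2 ^ w + 1 ≤ 2 ^ (w + 1) := by
    have := Nat.one_le_two_pow (n := w)
    rw [pow_succ]
    omega
  have h2 : 1 ≤ 2 ^ w := Nat.one_le_two_pow
  have h3 : w ≤ w * 2 ^ w := Nat.le_mul_of_pos_right _ h2
  have h4 : (w + 1) * (2 ^ w + 1) ≤ 4 * (w * 2 ^ w) := by nlinarith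
  calc 3 * 2 ^ w * (2 ^ w + 1) ^ (2 ^ w + 1)
      ≤ 2 ^ 2 * 2 ^ w * (2 ^ (w + 1)) ^ (2 ^ w + 1) := by gcongr; norm_num
    _ = 2 ^ (2 + w + (w + 1) * (2 ^ w + 1)) := by rw [← pow_mul, ← pow_add, ← pow_add]
    _ ≤ 2 ^ (7 * (w * 2 ^ w)) := Nat.pow_le_pow_right (by norm_num) (by omega)

theorem card_singletons_bound {w : ℕ} (hw : 1 ≤ w) :
    (3 * 2 ^ w * (w + 1) ^ (w + 1) : ℝ) ≤ 2 ^ (7 * (w * Real.logb 2 (max (w : ℝ) 2))) := by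
  set l := Real.logb 2 (max (w : ℝ) 2) with hl
  have hw' : (1 : ℝ) ≤ w := by exact_mod_cast hw
  have hpow : (2 : ℝ) ^ l = max (w : ℝ) 2 :=
    Real.rpow_logb (by norm_num) (by norm_num) (lt_max_of_lt_right two_pos)
  have hl1 : 1 ≤ l := by
    rw [hl, Real.le_logb_iff_rpow_le (by norm_num) (lt_max_of_lt_right two_pos), Real.rpow_one]
    exact le_max_right _ _
  -- The right side is `max w 2` squared. Again `7 = 3 + 4`, now in multiples of `w * l`, using `l ≥
  -- 1`.
  have h1 : (w + 1 : ℝ) ≤ 2 ^ (2 * l) := by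
    rw [two_mul, Real.rpow_add two_pos, hpow]
    nlinarith [le_max_left (w : ℝ) 2, le_max_right (w : ℝ) 2]
  have h2 : (w + 1 : ℝ) ^ (w + 1) ≤ 2 ^ (2 * l * (w + 1)) := by
    rw [Real.rpow_mul two_pos.le, ← Nat.cast_add_one, Real.rpow_natCast]
    push_cast
    exact pow_le_pow_left₀ (by positivity) h1 _
  have h3 : (3 * 2 ^ w : ℝ) ≤ 2 ^ (2 + w : ℝ) := by
    rw [Real.rpow_add two_pos, Real.rpow_natCast]
    gcongr
    norm_num
  calc (3 * 2 ^ w * (w + 1) ^ (w + 1) : ℝ)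
      ≤ 2 ^ (2 + w : ℝ) * 2 ^ (2 * l * (w + 1)) := by gcongr
    _ = 2 ^ (2 + w + 2 * l * (w + 1)) := by rw [← Real.rpow_add two_pos]
    _ ≤ 2 ^ (7 * (w * l)) := by
      refine Real.rpow_le_rpow_of_exponent_le (by norm_num) ?_
      nlinarith [mul_nonneg (sub_nonneg.2 hw') (sub_nonneg.2 hl1)]

/-! ### The two canonization transductions -/

theorem canonization_isFunctional {A : Type u} [Fintype A] [Nonempty A] [LinearOrder A] (w : ℕ) :
    IsFunctional (canonization A w) :=
  fun _ _ _ h h' => isCanonicalForm_unique h.1.1 h.2 h'.2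

theorem cdCanonization_isFunctional {A : Type u} [Fintype A] [Nonempty A] [LinearOrder A] (w : ℕ) :
    IsFunctional (cdCanonization A w) :=
  fun _ _ _ h h' => isCanonicalForm_unique h.1.1 h.2 h'.2

theorem dom_canonization {A : Type u} [Fintype A] [Nonempty A] [LinearOrder A] (w : ℕ) :
    dom (canonization A w) = odds A w := by
  ext D
  refine ⟨fun ⟨C, h⟩ => h.1, fun h => ?_⟩
  obtain ⟨C, hC⟩ := exists_isReducedForm h.1
  exact ⟨C, h, hC.isCanonicalForm⟩

theorem dom_cdCanonization {A : Type u} [Fintype A] [Nonempty A] [LinearOrder A] (w : ℕ) :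
    dom (cdCanonization A w) = cdOdds A w := by
  ext D
  refine ⟨fun ⟨C, h⟩ => h.1, fun h => ?_⟩
  obtain ⟨C, hC⟩ := exists_isReducedForm h.1
  exact ⟨C, h, hC.isCanonicalForm⟩

theorem level_subset_range {w k : ℕ} {B : ℕ → Layer A} (hk : 0 < k) (hB : ∀ i < k, B i ∈ layers A w)
    {i : ℕ} (hi : i ≤ k) : level B i ⊆ Finset.range w := by
  cases i with
  | zero => exact (hB 0 hk).1
  | succ i => exact (hB i hi).2

theorem canonization_isRegularTransduction {A : Type u} [Fintype A] [Nonempty A] [LinearOrder A]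
    (w : ℕ) : IsRegularTransduction (layers A w) (cdLayers A (2 ^ w))
      (3 * 2 ^ w * (2 ^ w + 1) ^ (2 ^ w + 1)) (canonization A w) := by
  have := isRegularTransduction_canonical (K := layers A w) (w := w)
    (P := (Finset.range w).powerset) subset_rfl fun B k h hB u i hi =>
      Finset.mem_powerset.2 ((reach_subset_level B u i).trans (level_subset_range h.pos hB hi))
  rw [Finset.card_powerset, Finset.card_range] at this
  exact this

theorem cdCanonization_isRegularTransduction {A : Type u} [Fintype A] [Nonempty A] [LinearOrder A]
    (w : ℕ) : IsRegularTransduction (cdLayers A w) (cdLayers A w)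
      (3 * 2 ^ w * (w + 1) ^ (w + 1)) (cdCanonization A w) := by
  have := isRegularTransduction_canonical (K := cdLayers A w) (w := w)
    (P := (Finset.range w).image fun q => {q}) (fun L hL => hL.1) fun B k h hB u i hi => by
      have hcd : IsCDSeq B k := ⟨h, fun i hi => (hB i hi).2.1, fun i hi => (hB i hi).2.2⟩
      rw [hcd.reach_eq u hi]
      exact Finset.mem_image_of_mem _
        (level_subset_range h.pos (fun i hi => (hB i hi).1) hi (hcd.run_mem u hi))
  rw [Finset.card_image_of_injective _ Finset.singleton_injective, Finset.card_range] at this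
  exact this

end ODD

theorem theorem3p2 :
    ∃ c : ℕ, ∀ (A : Type*) [Fintype A] [Nonempty A] [LinearOrder A] (w : ℕ), 1 ≤ w →
      (ODD.IsFunctional (ODD.canonization A w) ∧
        ODD.dom (ODD.canonization A w) = ODD.odds A w ∧
        ∃ n : ℕ, (n : ℝ) ≤ (2 : ℝ) ^ ((c : ℝ) * (Fintype.card A * w * 2 ^ w)) ∧
          ODD.IsRegularTransduction (ODD.layers A w) (ODD.cdLayers A (2 ^ w)) n
            (ODD.canonization A w)) ∧
      (ODD.IsFunctional (ODD.cdCanonization A w) ∧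
        ODD.dom (ODD.cdCanonization A w) = ODD.cdOdds A w ∧
        ∃ n : ℕ,
          (n : ℝ) ≤ (2 : ℝ) ^ ((c : ℝ) * (Fintype.card A * w * Real.logb 2 (max (w : ℝ) 2))) ∧
          ODD.IsRegularTransduction (ODD.cdLayers A w) (ODD.cdLayers A w) n
            (ODD.cdCanonization A w)) := by
  refine ⟨7, fun A _ _ _ w hw => ⟨⟨ODD.canonization_isFunctional w, ODD.dom_canonization w, _, ?_,
    ODD.canonization_isRegularTransduction w⟩, ODD.cdCanonization_isFunctional w,
    ODD.dom_cdCanonization w, _, ?_, ODD.cdCanonization_isRegularTransduction w⟩⟩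
  -- The alphabet enters only here: its size is at least one, so the factor merely weakens the
  -- bound.
  · have hA : 1 ≤ Fintype.card A := Fintype.card_pos
    have h : 3 * 2 ^ w * (2 ^ w + 1) ^ (2 ^ w + 1) ≤ 2 ^ (7 * (Fintype.card A * w * 2 ^ w)) := by
      refine (ODD.card_powerset_bound hw).trans (Nat.pow_le_pow_right two_pos ?_)
      rw [mul_assoc (Fintype.card A)]
      exact Nat.mul_le_mul_left 7 (Nat.le_mul_of_pos_left _ hA)
    have h' : ((3 * 2 ^ w * (2 ^ w + 1) ^ (2 ^ w + 1) : ℕ) : ℝ) ≤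
        (2 : ℝ) ^ (7 * (Fintype.card A * w * 2 ^ w)) := by exact_mod_cast h
    refine h'.trans_eq ?_
    rw [← Real.rpow_natCast]
    push_cast
    rfl
  · have hA : (1 : ℝ) ≤ Fintype.card A := by exact_mod_cast Fintype.card_pos (α := A)
    have hl : 0 ≤ Real.logb 2 (max (w : ℝ) 2) :=
      Real.logb_nonneg one_lt_two (le_max_of_le_right one_le_two)
    push_cast
    refine (ODD.card_singletons_bound hw).trans
      (Real.rpow_le_rpow_of_exponent_le one_le_two ?_)
    rw [mul_assoc (Fintype.card A : ℝ)]
    exact mul_le_mul_of_nonneg_left (le_mul_of_one_le_left (by positivity) hA) (by norm_num)
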